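/- Let $\gamma>0$ and $p\ge 2$ be real numbers, and let $f:\mathbb{R}\to\mathbb{R}$ be locally Lipschitz continuous with $f(0)=0$. If $p>2$, assume further that there exist $\epsilon_0>0$ and $a_0>0$ such that $$\frac{f(s)-f(t)}{s-t}\le -a_0\qquad\text{for all } s,t\in(0,\epsilon_0),\ s\ne t.$$ Let $(u,w)$ be a classical solution, i.e. $u,w\in C^2(\mathbb{R}^2)$ are real-valued and satisfy pointwise $$-\Delta u-\gamma\, w\,|u|^{p-2}u=f(u),\qquad -\Delta w=|u|^{p}\qquad\text{in }\mathbb{R}^2,$$ and suppose that $u>0$ on $\mathbb{R}^2$, $u\in L^\infty(\mathbb{R}^2)$, and $w(x)\to-\infty$ as $|x|\to\infty$. Then there is a point $x_0\in\mathbb{R}^2$ such that both $u$ and $w$ are radially symmetric and strictly decreasing with respect to $x_0$; that is, there are functions $\varphi,\psi:[0,\infty)\to\mathbb{R}$, both strictly decreasing, with $u(x)=\varphi(|x-x_0|)$ and $w(x)=\psi(|x-x_0|)$ for all $x\in\mathbb{R}^2$. -/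

import Mathlib

open Filter MeasureTheory Set

open scoped InnerProductSpace

/-- `(u, w)` is a classical (`C²`) solution on `ℝ²` of the generalized Schrödinger-Poisson system
`-Δu - γ w |u|^{p-2} u = f(u)`, `-Δw = |u|^p`. -/
structure IsClassicalSolution (γ p : ℝ) (f : ℝ → ℝ) (u w : EuclideanSpace ℝ (Fin 2) → ℝ) :
    Prop where
  contDiff_u : ContDiff ℝ 2 u
  contDiff_w : ContDiff ℝ 2 w
  eq_u : ∀ x, -(Laplacian.laplacian u x) - γ * w x * |u x| ^ (p - 2) * u x = f (u x)
  eq_w : ∀ x, -(Laplacian.laplacian w x) = |u x| ^ p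

/-- `v` is radially symmetric and strictly decreasing with respect to the point `x₀`: it is a
strictly decreasing function of the distance to `x₀`. -/
def IsRadiallyStrictlyDecreasing (v : EuclideanSpace ℝ (Fin 2) → ℝ)
    (x₀ : EuclideanSpace ℝ (Fin 2)) : Prop :=
  ∃ φ : ℝ → ℝ, StrictAntiOn φ (Ici 0) ∧ ∀ x, v x = φ ‖x - x₀‖

/-! The proof is the method of moving planes, run in the complex coordinate. Because `w → -∞`, the
equation for `u` is dissipative far out. This forces `u → 0` (`exists_u_le`), then exponential decay
(`exists_le_exp_norm`). The source `u ^ p` of the Poisson equation therefore decays fast, and circle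
means show that `w` falls at most logarithmically (`exists_log_le_w`).

For a vertical line `re = l`, let `v` and `z` be the reflected differences of `u` and `w` on the
half plane to its right. A barrier argument turns `v ≥ -V` into `z ≥ -const * V * exp (-c * l)`
(`neg_mul_le_reflDiff_w`). In the equation for `v`, at points far out, this coupling is weaker than
the dissipation, so negative minima of `v` stay in a fixed ball (`exists_norm_lt_of_isMin`). Hence
`v, z ≥ 0` for all large `l`, while `w → -∞` excludes very negative `l`.

At the infimum of admissible positions, the strong maximum principle gives `z = 0` or `z > 0`. If `z
> 0`, then `v > 0`, Hopf's lemma gives a nonzero normal derivative of `u` on the line, and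
compactness lets the line move further (`exists_good_of_lt`), a contradiction. So `z = 0`, whence `v
= 0`: the line is an axis of symmetry. It passes through every maximum of `w`; rotating the
coordinates produces an axis in every direction through one such point, which is radial symmetry.
Strict monotonicity comes from the positions before the infimum. -/

open Laplacian Topology

/-! ### Second derivatives along lines and the Laplacian. -/

section LaplacianTools

section Line

variable {E : Type*} [NormedAddCommGroup E] [NormedSpace ℝ E]

/-- The first derivative of a differentiable function along a line. -/
theorem DifferentiableAt.hasDerivAt_comp_line {f : E → ℝ} {x e : E} {t : ℝ}
    (hf : DifferentiableAt ℝ f (x + t • e)) :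
    HasDerivAt (fun t : ℝ => f (x + t • e)) (fderiv ℝ f (x + t • e) e) t := by
  have h : HasDerivAt (fun t : ℝ => x + t • e) e t := by
    simpa using ((hasDerivAt_id t).smul_const e).const_add x
  exact hf.hasFDerivAt.comp_hasDerivAt t h

theorem ContDiffAt.differentiableAt_fderiv_of_two {f : E → ℝ} {x : E} (hf : ContDiffAt ℝ 2 f x) :
    DifferentiableAt ℝ (fderiv ℝ f) x :=
  (hf.fderiv_right (m := 1) (by norm_num)).differentiableAt (by norm_num)

/-- The second derivative of a `C²` function along a line. -/
theorem ContDiffAt.hasDerivAt_fderiv_comp_line {f : E → ℝ} {x e : E} {t : ℝ}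
    (hf : ContDiffAt ℝ 2 f (x + t • e)) :
    HasDerivAt (fun t : ℝ => fderiv ℝ f (x + t • e) e)
      (iteratedFDeriv ℝ 2 f (x + t • e) ![e, e]) t := by
  have h : HasDerivAt (fun t : ℝ => x + t • e) e t := by
    simpa using ((hasDerivAt_id t).smul_const e).const_add x
  have h2 := hf.differentiableAt_fderiv_of_two.hasFDerivAt.comp_hasDerivAt t h
  rw [iteratedFDeriv_two_apply]
  simpa using h2.clm_apply (hasDerivAt_const t e)

theorem ContDiffAt.eventually_differentiableAt_line {f : E → ℝ} {x : E} (e : E)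
    (hf : ContDiffAt ℝ 2 f x) : ∀ᶠ t : ℝ in 𝓝 0, DifferentiableAt ℝ f (x + t • e) := by
  have h1 : ∀ᶠ y in 𝓝 x, DifferentiableAt ℝ f y := by
    filter_upwards [hf.eventually (by simp)] with y hy using hy.differentiableAt (by norm_num)
  have h2 : Tendsto (fun t : ℝ => x + t • e) (𝓝 0) (𝓝 x) := by
    have : Continuous (fun t : ℝ => x + t • e) := by fun_prop
    simpa using this.tendsto 0
  exact h2.eventually h1

theorem iteratedFDeriv_two_eq_of_hasDerivAt {f : E → ℝ} {x e : E} (hf : ContDiffAt ℝ 2 f x)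
    {g : ℝ → ℝ} {a : ℝ} (h1 : ∀ᶠ t in 𝓝 0, HasDerivAt (fun t : ℝ => f (x + t • e)) (g t) t)
    (h2 : HasDerivAt g a 0) : iteratedFDeriv ℝ 2 f x ![e, e] = a := by
  have h3 : HasDerivAt (fun t : ℝ => fderiv ℝ f (x + t • e) e)
      (iteratedFDeriv ℝ 2 f x ![e, e]) 0 := by
    simpa using ContDiffAt.hasDerivAt_fderiv_comp_line (f := f) (x := x) (e := e) (t := 0)
      (by simpa using hf)
  have h4 : (fun t : ℝ => fderiv ℝ f (x + t • e) e) =ᶠ[𝓝 0] g := by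
    filter_upwards [h1, hf.eventually_differentiableAt_line e] with t ht ht'
    exact ht'.hasDerivAt_comp_line.unique ht
  exact (h3.congr_of_eventuallyEq h4.symm).unique h2

/-- Second derivative test, in the necessary direction. -/
theorem IsLocalMin.iteratedFDeriv_two_nonneg {f : E → ℝ} {x : E} (hm : IsLocalMin f x)
    (hf : ContDiffAt ℝ 2 f x) (e : E) : 0 ≤ iteratedFDeriv ℝ 2 f x ![e, e] := by
  by_contra! hneg
  set F : ℝ → ℝ := fun t => f (x + t • e) with hF
  have hcont : Tendsto (fun t : ℝ => x + t • e) (𝓝 0) (𝓝 x) := by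
    have : Continuous (fun t : ℝ => x + t • e) := by fun_prop
    simpa using this.tendsto 0
  have hFmin : IsLocalMin F 0 := by
    have := hcont.eventually hm
    simpa [IsLocalMin, IsMinFilter, hF] using this
  have hd : ∀ᶠ t in 𝓝 (0 : ℝ), HasDerivAt F (fderiv ℝ f (x + t • e) e) t := by
    filter_upwards [hf.eventually_differentiableAt_line e] with t ht
    exact ht.hasDerivAt_comp_line
  have hderiv : deriv F =ᶠ[𝓝 0] fun t => fderiv ℝ f (x + t • e) e := by
    filter_upwards [hd] with t ht using ht.deriv
  have h3 : HasDerivAt (fun t : ℝ => fderiv ℝ f (x + t • e) e)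
      (iteratedFDeriv ℝ 2 f x ![e, e]) 0 := by
    simpa using ContDiffAt.hasDerivAt_fderiv_comp_line (f := f) (x := x) (e := e) (t := 0)
      (by simpa using hf)
  have h4 : deriv (deriv F) 0 = iteratedFDeriv ℝ 2 f x ![e, e] := by
    rw [hderiv.deriv_eq]; exact h3.deriv
  have hmax : IsLocalMax F 0 := isLocalMax_of_deriv_deriv_neg (by rw [h4]; exact hneg)
    hFmin.deriv_eq_zero hd.self_of_nhds.continuousAt
  have hconst : F =ᶠ[𝓝 0] fun _ => F 0 := by
    filter_upwards [hFmin, hmax] with t h1 h2 using le_antisymm h2 h1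
  have h5 : deriv (deriv F) 0 = 0 := by
    rw [hconst.deriv.deriv_eq]; simp
  rw [h5] at h4
  exact hneg.ne h4.symm

end Line

variable {E E' : Type*} [NormedAddCommGroup E] [InnerProductSpace ℝ E] [FiniteDimensional ℝ E]
  [NormedAddCommGroup E'] [InnerProductSpace ℝ E'] [FiniteDimensional ℝ E']

/-- The form of the maximum principle behind the barrier arguments: a comparison function with
negative Laplacian at an interior minimum is contradictory. -/
theorem IsLocalMin.laplacian_nonneg {f : E → ℝ} {x : E} (hm : IsLocalMin f x)
    (hf : ContDiffAt ℝ 2 f x) : 0 ≤ Δ f x := by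
  rw [InnerProductSpace.laplacian_eq_iteratedFDeriv_stdOrthonormalBasis]
  exact Finset.sum_nonneg fun i _ => hm.iteratedFDeriv_two_nonneg hf _

/-- The trace of the Hessian may be taken in any orthonormal basis, here one basis and its image
under `L`. -/
theorem laplacian_comp_isometry (f : E' → ℝ) (L : E ≃ₗᵢ[ℝ] E') (c : E') (x : E) :
    Δ (fun y => f (L y + c)) x = Δ f (L x + c) := by
  rw [InnerProductSpace.laplacian_eq_iteratedFDeriv_orthonormalBasis _ (stdOrthonormalBasis ℝ E),
    InnerProductSpace.laplacian_eq_iteratedFDeriv_orthonormalBasis f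
      ((stdOrthonormalBasis ℝ E).map L)]
  refine Finset.sum_congr rfl fun i _ => ?_
  have h := L.toContinuousLinearEquiv.iteratedFDerivWithin_comp_right (fun y => f (y + c))
    uniqueDiffOn_univ (mem_univ (L.toContinuousLinearEquiv x)) 2
  have h' : (fun y => f (y + c)) ∘ L.toContinuousLinearEquiv = fun y => f (L y + c) := rfl
  rw [h', preimage_univ, iteratedFDerivWithin_univ, iteratedFDerivWithin_univ] at h
  rw [h, iteratedFDeriv_comp_add_right]
  simp only [ContinuousMultilinearMap.compContinuousLinearMap_apply]
  congr 1
  ext j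
  fin_cases j <;> simp

theorem laplacian_eq_of_hasDerivAt {f : ℂ → ℝ} {z : ℂ} (hf : ContDiffAt ℝ 2 f z)
    {g₁ g₂ : ℝ → ℝ} {a b : ℝ}
    (h1 : ∀ᶠ t in 𝓝 0, HasDerivAt (fun t : ℝ => f (z + t • (1 : ℂ))) (g₁ t) t)
    (h1' : HasDerivAt g₁ a 0)
    (h2 : ∀ᶠ t in 𝓝 0, HasDerivAt (fun t : ℝ => f (z + t • Complex.I)) (g₂ t) t)
    (h2' : HasDerivAt g₂ b 0) : Δ f z = a + b := by
  rw [InnerProductSpace.laplacian_eq_iteratedFDeriv_complexPlane]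
  show iteratedFDeriv ℝ 2 f z ![1, 1] + iteratedFDeriv ℝ 2 f z ![Complex.I, Complex.I] = a + b
  rw [iteratedFDeriv_two_eq_of_hasDerivAt hf h1 h1', iteratedFDeriv_two_eq_of_hasDerivAt hf h2 h2']

/-- The Laplacian of a product of functions of the two coordinates. -/
theorem laplacian_mul_re_im {φ φ' φ'' ψ ψ' ψ'' : ℝ → ℝ} (hφ : ContDiff ℝ 2 φ) (hψ : ContDiff ℝ 2 ψ)
    (h1 : ∀ t, HasDerivAt φ (φ' t) t) (h2 : ∀ t, HasDerivAt φ' (φ'' t) t)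
    (h3 : ∀ t, HasDerivAt ψ (ψ' t) t) (h4 : ∀ t, HasDerivAt ψ' (ψ'' t) t) (z : ℂ) :
    Δ (fun z : ℂ => φ z.re * ψ z.im) z = φ'' z.re * ψ z.im + φ z.re * ψ'' z.im := by
  have hre : ContDiff ℝ 2 Complex.re := Complex.reCLM.contDiff
  have him : ContDiff ℝ 2 Complex.im := Complex.imCLM.contDiff
  have hr : ∀ t : ℝ, HasDerivAt (fun t : ℝ => z.re + t) 1 t := fun t => by
    simpa using (hasDerivAt_id t).const_add z.re
  have hi : ∀ t : ℝ, HasDerivAt (fun t : ℝ => z.im + t) 1 t := fun t => by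
    simpa using (hasDerivAt_id t).const_add z.im
  refine laplacian_eq_of_hasDerivAt ((hφ.comp hre).mul (hψ.comp him)).contDiffAt
    (g₁ := fun t => φ' (z.re + t) * ψ z.im) (g₂ := fun t => φ z.re * ψ' (z.im + t))
    (Eventually.of_forall fun t => ?_) ?_ (Eventually.of_forall fun t => ?_) ?_
  · have := ((h1 (z.re + t)).comp t (hr t)).mul_const (ψ z.im)
    simpa [Function.comp_def] using this
  · have := ((h2 (z.re + 0)).comp 0 (hr 0)).mul_const (ψ z.im)
    simpa [Function.comp_def] using this
  · have := ((h3 (z.im + t)).comp t (hi t)).const_mul (φ z.re)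
    simpa [Function.comp_def] using this
  · have := ((h4 (z.im + 0)).comp 0 (hi 0)).const_mul (φ z.re)
    simpa [Function.comp_def] using this

theorem contDiff_mul_re_im {φ ψ : ℝ → ℝ} (hφ : ContDiff ℝ 2 φ) (hψ : ContDiff ℝ 2 ψ) :
    ContDiff ℝ 2 (fun z : ℂ => φ z.re * ψ z.im) :=
  (hφ.comp Complex.reCLM.contDiff).mul (hψ.comp Complex.imCLM.contDiff)

/-- The real part of the square root, a harmonic function on the slit plane. -/
noncomputable def reSqrt (z : ℂ) : ℝ := (z ^ (1 / 2 : ℂ)).re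

theorem contDiffAt_reSqrt {z : ℂ} (hz : z ∈ Complex.slitPlane) : ContDiffAt ℝ 2 reSqrt z := by
  have h : AnalyticAt ℂ (fun z : ℂ => z ^ (1 / 2 : ℂ)) z := analyticAt_id.cpow analyticAt_const hz
  exact h.harmonicAt_re.1

theorem laplacian_reSqrt {z : ℂ} (hz : z ∈ Complex.slitPlane) : Δ reSqrt z = 0 := by
  have h : AnalyticAt ℂ (fun z : ℂ => z ^ (1 / 2 : ℂ)) z := analyticAt_id.cpow analyticAt_const hz
  exact h.harmonicAt_re.2.self_of_nhds

/-- On the right half plane the argument of the root is below `π / 4` in absolute value. The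
resulting square-root growth makes `reSqrt` a harmonic barrier that beats logarithms. -/
theorem reSqrt_ge {z : ℂ} (hz : 0 < z.re) : √‖z‖ / 2 ≤ reSqrt z := by
  have hz0 : z ≠ 0 := by rintro rfl; simp at hz
  have h1 : |z.arg| < Real.pi / 2 := Complex.abs_arg_lt_pi_div_two_iff.2 (Or.inl hz)
  have h2 : reSqrt z = √‖z‖ * Real.cos (z.arg / 2) := by
    unfold reSqrt
    have : (1 / 2 : ℂ) = ((1 / 2 : ℝ) : ℂ) := by push_cast; rfl
    rw [this, Complex.cpow_ofReal_re, Real.sqrt_eq_rpow]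
    congr 2; ring
  rw [h2]
  have h3 : (1 : ℝ) / 2 ≤ Real.cos (z.arg / 2) := by
    rw [← Real.cos_pi_div_three, ← Real.cos_abs (z.arg / 2)]
    refine Real.cos_le_cos_of_nonneg_of_le_pi (abs_nonneg _) (by linarith [Real.pi_pos]) ?_
    rw [abs_div, abs_two]; linarith [Real.pi_pos]
  nlinarith [Real.sqrt_nonneg ‖z‖]

end LaplacianTools

/-! ### Circle means as functions of the logarithmic radius. -/

section CircleMean

theorem hasDerivAt_intervalIntegral_of_continuous {F F' : ℝ → ℝ → ℝ} {a b : ℝ}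
    (hF : Continuous (Function.uncurry F)) (hF' : Continuous (Function.uncurry F'))
    (h : ∀ s θ, HasDerivAt (fun s => F s θ) (F' s θ) s) (s : ℝ) :
    HasDerivAt (fun s => ∫ θ in a..b, F s θ) (∫ θ in a..b, F' s θ) s := by
  have hc : ∀ s, Continuous (F s) := fun s => hF.comp (by fun_prop : Continuous fun θ => (s, θ))
  have hc' : ∀ s, Continuous (F' s) := fun s => hF'.comp (by fun_prop : Continuous fun θ => (s, θ))
  obtain ⟨C, hC⟩ :=
    ((isCompact_closedBall s 1).prod (isCompact_uIcc (a := a) (b := b))).bddAbove_image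
      hF'.norm.continuousOn
  refine (intervalIntegral.hasDerivAt_integral_of_dominated_loc_of_deriv_le (bound := fun _ => C)
    (Metric.closedBall_mem_nhds s one_pos)
    (Eventually.of_forall fun s => (hc s).aestronglyMeasurable) ((hc s).intervalIntegrable _ _)
    (hc' s).aestronglyMeasurable (Eventually.of_forall fun θ hθ t ht => ?_)
    intervalIntegrable_const (Eventually.of_forall fun θ _ t _ => h t θ)).2
  exact hC ⟨(t, θ), ⟨ht, uIoc_subset_uIcc hθ⟩, rfl⟩

/-- The integral of `g` over the circle of radius `r` around `x`, with respect to the angle. -/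
noncomputable def circleMean (g : ℂ → ℝ) (x : ℂ) (r : ℝ) : ℝ :=
  ∫ θ in (-Real.pi)..Real.pi, g (x + r * Complex.exp (θ * Complex.I))

theorem continuous_circleMean {g : ℂ → ℝ} (hg : Continuous g) (x : ℂ) :
    Continuous (circleMean g x) := by
  unfold circleMean
  refine intervalIntegral.continuous_parametric_intervalIntegral_of_continuous' ?_ _ _
  fun_prop

theorem circleMean_zero (g : ℂ → ℝ) (x : ℂ) : circleMean g x 0 = 2 * Real.pi * g x := by
  simp only [circleMean, Complex.ofReal_zero, zero_mul, add_zero,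
    intervalIntegral.integral_const, smul_eq_mul]
  ring

theorem circleMean_mono {g h : ℂ → ℝ} (hg : Continuous g) (hh : Continuous h) {x : ℂ} {r : ℝ}
    (hle : ∀ θ : ℝ, g (x + r * Complex.exp (θ * Complex.I)) ≤
      h (x + r * Complex.exp (θ * Complex.I))) :
    circleMean g x r ≤ circleMean h x r := by
  unfold circleMean
  refine intervalIntegral.integral_mono_on (by linarith [Real.pi_pos]) ?_ ?_ fun θ _ => hle θ
  · exact Continuous.intervalIntegrable (by fun_prop) _ _
  · exact Continuous.intervalIntegrable (by fun_prop) _ _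

theorem circleMean_const (c : ℝ) (x : ℂ) (r : ℝ) :
    circleMean (fun _ => c) x r = 2 * Real.pi * c := by
  simp only [circleMean, intervalIntegral.integral_const, smul_eq_mul]
  ring

/-- The angular integral of the radial derivative of `g`. -/
noncomputable def circleFlux (g : ℂ → ℝ) (x : ℂ) (r : ℝ) : ℝ :=
  ∫ θ in (-Real.pi)..Real.pi,
    fderiv ℝ g (x + r * Complex.exp (θ * Complex.I)) (Complex.exp (θ * Complex.I))

theorem continuous_circleFlux {g : ℂ → ℝ} (hg : ContDiff ℝ 2 g) (x : ℂ) :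
    Continuous (circleFlux g x) := by
  have h1 : Continuous (fderiv ℝ g) := hg.continuous_fderiv (by norm_num)
  unfold circleFlux
  refine intervalIntegral.continuous_parametric_intervalIntegral_of_continuous' ?_ _ _
  exact Continuous.clm_apply (h1.comp (by fun_prop)) (by fun_prop)

theorem exp_add_mul_I (s θ : ℝ) : Complex.exp (s + θ * Complex.I) =
    (Real.exp s : ℝ) * Complex.exp (θ * Complex.I) := by
  rw [Complex.exp_add]; push_cast; rfl

theorem hasDerivAt_exp_radial (s θ : ℝ) :
    HasDerivAt (fun s : ℝ => Complex.exp (s + θ * Complex.I))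
      (Complex.exp (s + θ * Complex.I)) s := by
  have h : HasDerivAt (fun s : ℝ => (s : ℂ) + θ * Complex.I) 1 s :=
    (Complex.ofRealCLM.hasDerivAt (x := s)).add_const _
  simpa using h.cexp

theorem hasDerivAt_exp_angular (s θ : ℝ) :
    HasDerivAt (fun θ : ℝ => Complex.exp (s + θ * Complex.I))
      (Complex.I * Complex.exp (s + θ * Complex.I)) θ := by
  have h : HasDerivAt (fun θ : ℝ => (s : ℂ) + θ * Complex.I) Complex.I θ := by
    simpa using ((Complex.ofRealCLM.hasDerivAt (x := θ)).mul_const Complex.I).const_add (s : ℂ)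
  simpa [mul_comm] using h.cexp

/-- With `r = exp s` one has `r² Δ = ∂_s² + ∂_θ²`, with no first-order term and no singularity. -/
theorem ContDiff.hasDerivAt_circleMean_exp {g : ℂ → ℝ} (hg : ContDiff ℝ 2 g) (x : ℂ) (s : ℝ) :
    HasDerivAt (fun s => circleMean g x (Real.exp s))
      (Real.exp s * circleFlux g x (Real.exp s)) s := by
  have hg1 : Continuous (fderiv ℝ g) := hg.continuous_fderiv (by norm_num)
  have hgc := hg.continuous
  have key := hasDerivAt_intervalIntegral_of_continuous (a := -Real.pi) (b := Real.pi)
    (F := fun s θ => g (x + Complex.exp (s + θ * Complex.I)))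
    (F' := fun s θ => fderiv ℝ g (x + Complex.exp (s + θ * Complex.I))
      (Complex.exp (s + θ * Complex.I)))
    (by unfold Function.uncurry; fun_prop)
    (by
      unfold Function.uncurry
      exact Continuous.clm_apply (hg1.comp (by fun_prop)) (by fun_prop))
    (fun s θ => ((hg.differentiable (by norm_num)) _).hasFDerivAt.comp_hasDerivAt s
      ((hasDerivAt_exp_radial s θ).const_add x)) s
  simp only [exp_add_mul_I] at key
  have key' : HasDerivAt (fun s => circleMean g x (Real.exp s)) _ s := key
  refine key'.congr_deriv ?_
  rw [circleFlux, ← intervalIntegral.integral_const_mul]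
  refine intervalIntegral.integral_congr fun θ _ => ?_
  simp only [← Complex.real_smul, map_smul, smul_eq_mul]

theorem sum_iteratedFDeriv_two_mul_I {g : ℂ → ℝ} {y : ℂ} (a : ℂ) :
    fderiv ℝ (fderiv ℝ g) y a a + fderiv ℝ (fderiv ℝ g) y (Complex.I * a) (Complex.I * a) =
      ‖a‖ ^ 2 * Δ g y := by
  rw [InnerProductSpace.laplacian_eq_iteratedFDeriv_complexPlane]
  simp only [iteratedFDeriv_two_apply]
  have ha : a = a.re • (1 : ℂ) + a.im • Complex.I := by
    simp [Complex.re_add_im]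
  have hb : Complex.I * a = (-a.im) • (1 : ℂ) + a.re • Complex.I := by
    apply Complex.ext <;> simp
  have hn : ‖a‖ ^ 2 = a.re ^ 2 + a.im ^ 2 := by
    rw [Complex.sq_norm, Complex.normSq_apply]; ring
  rw [hb, hn]
  conv_lhs => rw [ha]
  simp only [map_add, map_smul, add_apply, smul_apply,
    smul_eq_mul]
  simp
  ring

theorem ContDiff.continuous_laplacian {g : ℂ → ℝ} (hg : ContDiff ℝ 2 g) : Continuous (Δ g) := by
  rw [InnerProductSpace.laplacian_eq_iteratedFDeriv_complexPlane]
  simp only [iteratedFDeriv_two_apply]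
  have h1 : Continuous (fderiv ℝ (fderiv ℝ g)) :=
    (hg.fderiv_right (m := 1) (by norm_num)).continuous_fderiv (by norm_num)
  exact ((h1.clm_apply continuous_const).clm_apply continuous_const).add
    ((h1.clm_apply continuous_const).clm_apply continuous_const)

/-- The second logarithmic radial derivative of the circle mean is the mean of the Laplacian. -/
theorem ContDiff.hasDerivAt_circleFlux_exp {g : ℂ → ℝ} (hg : ContDiff ℝ 2 g) (x : ℂ) (s : ℝ) :
    HasDerivAt (fun s => Real.exp s * circleFlux g x (Real.exp s))
      (Real.exp s ^ 2 * circleMean (Δ g) x (Real.exp s)) s := by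
  have hg1 : Continuous (fderiv ℝ g) := hg.continuous_fderiv (by norm_num)
  have hgd : ContDiff ℝ 1 (fderiv ℝ g) := hg.fderiv_right (m := 1) (by norm_num)
  have hg2 : Continuous (fderiv ℝ (fderiv ℝ g)) := hgd.continuous_fderiv (by norm_num)
  have hdd : Differentiable ℝ (fderiv ℝ g) := hgd.differentiable (by norm_num)
  have hcont : Continuous fun p : ℝ × ℝ => fderiv ℝ (fderiv ℝ g)
      (x + Complex.exp (p.1 + p.2 * Complex.I)) (Complex.exp (p.1 + p.2 * Complex.I))
        (Complex.exp (p.1 + p.2 * Complex.I)) +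
      fderiv ℝ g (x + Complex.exp (p.1 + p.2 * Complex.I))
        (Complex.exp (p.1 + p.2 * Complex.I)) := by
    refine Continuous.add (Continuous.clm_apply (Continuous.clm_apply (hg2.comp (by fun_prop))
      (by fun_prop)) (by fun_prop)) (Continuous.clm_apply (hg1.comp (by fun_prop)) (by fun_prop))
  have key := hasDerivAt_intervalIntegral_of_continuous (a := -Real.pi) (b := Real.pi)
    (F := fun s θ => fderiv ℝ g (x + Complex.exp (s + θ * Complex.I))
      (Complex.exp (s + θ * Complex.I)))
    (F' := fun s θ => fderiv ℝ (fderiv ℝ g) (x + Complex.exp (s + θ * Complex.I))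
      (Complex.exp (s + θ * Complex.I)) (Complex.exp (s + θ * Complex.I)) +
      fderiv ℝ g (x + Complex.exp (s + θ * Complex.I)) (Complex.exp (s + θ * Complex.I)))
    (by
      unfold Function.uncurry
      exact Continuous.clm_apply (hg1.comp (by fun_prop)) (by fun_prop))
    hcont
    (fun s θ => ((hdd _).hasFDerivAt.comp_hasDerivAt s
      ((hasDerivAt_exp_radial s θ).const_add x)).clm_apply (hasDerivAt_exp_radial s θ)) s
  have hL : (fun s => Real.exp s * circleFlux g x (Real.exp s)) = fun s : ℝ =>
      ∫ θ in (-Real.pi)..Real.pi, fderiv ℝ g (x + Complex.exp (s + θ * Complex.I))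
        (Complex.exp (s + θ * Complex.I)) := by
    funext s
    rw [circleFlux, ← intervalIntegral.integral_const_mul]
    refine intervalIntegral.integral_congr fun θ _ => ?_
    simp only [← exp_add_mul_I]
    rw [← smul_eq_mul, ← map_smul, Complex.real_smul, ← exp_add_mul_I]
  rw [hL]
  convert key using 1
  -- `Q` is the second angular derivative of `g (x + exp (s + θ I))`. Its integral over a period is
  -- zero, so adding it completes `∂_s²` to the Laplacian.
  set Q : ℝ → ℝ := fun θ => fderiv ℝ (fderiv ℝ g) (x + Complex.exp (s + θ * Complex.I))
      (Complex.I * Complex.exp (s + θ * Complex.I)) (Complex.I * Complex.exp (s + θ * Complex.I)) -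
      fderiv ℝ g (x + Complex.exp (s + θ * Complex.I)) (Complex.exp (s + θ * Complex.I)) with hQ
  have hQc : Continuous Q := by
    refine Continuous.sub (Continuous.clm_apply (Continuous.clm_apply (hg2.comp (by fun_prop))
      (by fun_prop)) (by fun_prop)) (Continuous.clm_apply (hg1.comp (by fun_prop)) (by fun_prop))
  have hQint : ∫ θ in (-Real.pi)..Real.pi, Q θ = 0 := by
    rw [intervalIntegral.integral_eq_sub_of_hasDerivAt (f := fun θ : ℝ =>
      fderiv ℝ g (x + Complex.exp (s + θ * Complex.I))
        (Complex.I * Complex.exp (s + θ * Complex.I))) _ (hQc.intervalIntegrable _ _)]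
    · have : Complex.exp (s + (Real.pi : ℝ) * Complex.I) =
          Complex.exp (s + ((-Real.pi : ℝ) : ℂ) * Complex.I) := by
        rw [Complex.exp_add, Complex.exp_add]; simp [Complex.exp_neg, Complex.exp_pi_mul_I]
      simp only [this, sub_self]
    · intro θ _
      have h := ((hdd _).hasFDerivAt.comp_hasDerivAt θ
        ((hasDerivAt_exp_angular s θ).const_add x)).clm_apply
          ((hasDerivAt_exp_angular s θ).const_mul Complex.I)
      refine h.congr_deriv ?_
      have : Complex.I * (Complex.I * Complex.exp (s + θ * Complex.I)) =
          -Complex.exp (s + θ * Complex.I) := by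
        rw [← mul_assoc, Complex.I_mul_I]; ring
      simp only [hQ, this, map_neg, Function.comp]
      ring
  have hcont' : Continuous fun θ : ℝ => fderiv ℝ (fderiv ℝ g)
      (x + Complex.exp (s + θ * Complex.I)) (Complex.exp (s + θ * Complex.I))
        (Complex.exp (s + θ * Complex.I)) +
      fderiv ℝ g (x + Complex.exp (s + θ * Complex.I)) (Complex.exp (s + θ * Complex.I)) :=
    hcont.comp (by fun_prop : Continuous fun θ : ℝ => (s, θ))
  rw [← add_zero (∫ θ in (-Real.pi)..Real.pi, _), ← hQint, ← intervalIntegral.integral_add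
    (hcont'.intervalIntegrable _ _)
    (hQc.intervalIntegrable _ _), circleMean, ← intervalIntegral.integral_const_mul]
  refine intervalIntegral.integral_congr fun θ _ => ?_
  have h := sum_iteratedFDeriv_two_mul_I (g := g) (y := x + Complex.exp (s + θ * Complex.I))
    (Complex.exp (s + θ * Complex.I))
  have hn : ‖Complex.exp (s + θ * Complex.I)‖ = Real.exp s := by
    rw [Complex.norm_exp]; simp
  rw [hn] at h
  simp only [hQ]
  rw [← exp_add_mul_I, ← h]
  ring

end CircleMean

/-! ### Mean value inequalities, the strong maximum principle and logarithmic growth. -/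

section Subharmonic

theorem tendsto_circleMean_exp_atBot {g : ℂ → ℝ} (hg : Continuous g) (x : ℂ) :
    Tendsto (fun s => circleMean g x (Real.exp s)) atBot (𝓝 (2 * Real.pi * g x)) := by
  rw [← circleMean_zero g x]
  exact ((continuous_circleMean hg x).tendsto 0).comp Real.tendsto_exp_atBot

theorem tendsto_circleFlux_exp_atBot {g : ℂ → ℝ} (hg : ContDiff ℝ 2 g) (x : ℂ) :
    Tendsto (fun s => Real.exp s * circleFlux g x (Real.exp s)) atBot (𝓝 0) := by
  have h := Real.tendsto_exp_atBot.mul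
    (((continuous_circleFlux hg x).tendsto 0).comp Real.tendsto_exp_atBot)
  simpa using h

theorem circleMean_nonneg {g : ℂ → ℝ} {x : ℂ} {r : ℝ}
    (h : ∀ θ : ℝ, 0 ≤ g (x + r * Complex.exp (θ * Complex.I))) : 0 ≤ circleMean g x r :=
  intervalIntegral.integral_nonneg (by linarith [Real.pi_pos]) fun θ _ => h θ

theorem norm_mul_exp_mul_I {r : ℝ} (hr : 0 ≤ r) (θ : ℝ) :
    ‖(r : ℂ) * Complex.exp (θ * Complex.I)‖ = r := by
  rw [norm_mul, Complex.norm_exp_ofReal_mul_I, Complex.norm_real, mul_one, Real.norm_of_nonneg hr]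

/-- Circle means of a subharmonic function are increasing in the radius. -/
theorem monotoneOn_circleMean_exp {g : ℂ → ℝ} (hg : ContDiff ℝ 2 g) {x : ℂ} {ρ : ℝ}
    (hρ : 0 < ρ) (hsub : ∀ y ∈ Metric.ball x ρ, 0 ≤ Δ g y) :
    MonotoneOn (fun s => circleMean g x (Real.exp s)) (Iio (Real.log ρ)) := by
  have hF : MonotoneOn (fun s => Real.exp s * circleFlux g x (Real.exp s)) (Iio (Real.log ρ)) := by
    refine monotoneOn_of_deriv_nonneg (convex_Iio _)
      (fun s _ => (hg.hasDerivAt_circleFlux_exp x s).continuousAt.continuousWithinAt)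
      (fun s _ => (hg.hasDerivAt_circleFlux_exp x s).differentiableAt.differentiableWithinAt)
      fun s hs => ?_
    rw [interior_Iio] at hs
    rw [(hg.hasDerivAt_circleFlux_exp x s).deriv]
    refine mul_nonneg (by positivity) (circleMean_nonneg fun θ => hsub _ ?_)
    rw [Metric.mem_ball, dist_eq_norm, add_sub_cancel_left, norm_mul_exp_mul_I (Real.exp_pos s).le]
    exact (Real.lt_log_iff_exp_lt hρ).1 hs
  refine monotoneOn_of_deriv_nonneg (convex_Iio _)
    (fun s _ => (hg.hasDerivAt_circleMean_exp x s).continuousAt.continuousWithinAt)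
    (fun s _ => (hg.hasDerivAt_circleMean_exp x s).differentiableAt.differentiableWithinAt)
    fun s hs => ?_
  rw [interior_Iio] at hs
  rw [(hg.hasDerivAt_circleMean_exp x s).deriv]
  -- The flux is monotone and tends to `0` as the radius shrinks, so it is nonnegative.
  refine le_of_tendsto (tendsto_circleFlux_exp_atBot hg x) ?_
  filter_upwards [eventually_le_atBot s] with t ht
  exact hF (lt_of_le_of_lt ht hs) hs ht

/-- The sub-mean value property. -/
theorem le_circleMean_of_laplacian_nonneg {g : ℂ → ℝ} (hg : ContDiff ℝ 2 g) {x : ℂ} {ρ r : ℝ}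
    (hsub : ∀ y ∈ Metric.ball x ρ, 0 ≤ Δ g y) (hr : 0 < r) (hrρ : r < ρ) :
    2 * Real.pi * g x ≤ circleMean g x r := by
  have hρ := hr.trans hrρ
  have hm := monotoneOn_circleMean_exp hg hρ hsub
  have hlog : Real.log r < Real.log ρ := Real.log_lt_log hr hrρ
  have h : 2 * Real.pi * g x ≤ circleMean g x (Real.exp (Real.log r)) := by
    refine le_of_tendsto (tendsto_circleMean_exp_atBot hg.continuous x) ?_
    filter_upwards [eventually_le_atBot (Real.log r)] with t ht
    exact hm (lt_of_le_of_lt ht hlog) hlog ht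
  rwa [Real.exp_log hr] at h

/-- If a nonnegative superharmonic function vanishes at a point, it vanishes nearby. -/
theorem eq_zero_of_laplacian_nonpos_of_eq_zero {g : ℂ → ℝ} (hg : ContDiff ℝ 2 g) {x : ℂ} {ρ : ℝ}
    (hsup : ∀ y ∈ Metric.ball x ρ, Δ g y ≤ 0) (hnn : ∀ y ∈ Metric.ball x ρ, 0 ≤ g y)
    (hx : g x = 0) : ∀ y ∈ Metric.ball x ρ, g y = 0 := by
  intro y hy
  by_contra hne
  have hpos : 0 < g y := lt_of_le_of_ne (hnn y hy) (Ne.symm hne)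
  set r := ‖y - x‖ with hr
  have hrρ : r < ρ := by rwa [Metric.mem_ball, dist_eq_norm] at hy
  have hr0 : 0 < r := by
    refine norm_pos_iff.2 (sub_ne_zero.2 ?_)
    rintro rfl
    exact hne hx
  -- The sub-mean value property of `-g` makes the mean of `g` nonpositive on the circle through
  -- `y`, where `g` is nonnegative and positive at `y`.
  have h1 := le_circleMean_of_laplacian_nonneg (g := -g) hg.neg (x := x) (ρ := ρ) (r := r)
    (fun y hy => by
      rw [InnerProductSpace.laplacian_neg]
      simpa using hsup y hy) hr0 hrρ
  have hneg : circleMean (-g) x r = -circleMean g x r := by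
    simp [circleMean]
  rw [hneg, Pi.neg_apply, hx] at h1
  have hgc := hg.continuous
  have h2 : 0 < circleMean g x r := by
    refine intervalIntegral.integral_pos (by linarith [Real.pi_pos])
      (Continuous.continuousOn (by fun_prop)) (fun θ _ => hnn _ ?_)
      ⟨(y - x).arg, ⟨(Complex.neg_pi_lt_arg _).le, Complex.arg_le_pi _⟩, ?_⟩
    · rw [Metric.mem_ball, dist_eq_norm, add_sub_cancel_left, norm_mul_exp_mul_I hr0.le]
      exact hrρ
    · rw [hr, Complex.norm_mul_exp_arg_mul_I, add_sub_cancel]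
      exact hpos
  linarith

/-- The strong maximum principle for nonnegative superharmonic functions. -/
theorem eqOn_zero_of_laplacian_nonpos {g : ℂ → ℝ} (hg : ContDiff ℝ 2 g) {U : Set ℂ}
    (hU : IsOpen U) (hUc : IsPreconnected U) (hsup : ∀ y ∈ U, Δ g y ≤ 0) (hnn : ∀ y ∈ U, 0 ≤ g y)
    {x : ℂ} (hxU : x ∈ U) (hx : g x = 0) : ∀ y ∈ U, g y = 0 := by
  by_contra! hcon
  obtain ⟨y, hyU, hy⟩ := hcon
  have hV : IsOpen (U ∩ {z | 0 < g z}) := hU.inter (isOpen_lt continuous_const hg.continuous)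
  have hW : IsOpen (interior (U ∩ {z | g z = 0})) := isOpen_interior
  have hsubset : U ⊆ (U ∩ {z | 0 < g z}) ∪ interior (U ∩ {z | g z = 0}) := by
    intro z hz
    rcases (hnn z hz).lt_or_eq with h | h
    · exact Or.inl ⟨hz, h⟩
    · right
      obtain ⟨ρ, hρ, hball⟩ := Metric.isOpen_iff.1 hU z hz
      refine mem_interior.2 ⟨Metric.ball z ρ, fun a ha => ⟨hball ha, ?_⟩, Metric.isOpen_ball,
        Metric.mem_ball_self hρ⟩
      exact eq_zero_of_laplacian_nonpos_of_eq_zero hg (fun b hb => hsup b (hball hb))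
        (fun b hb => hnn b (hball hb)) h.symm a ha
  have hxW : x ∈ interior (U ∩ {z | g z = 0}) := by
    rcases hsubset hxU with h | h
    · exact absurd hx h.2.ne'
    · exact h
  obtain ⟨z, _, hz1, hz2⟩ := hUc _ _ hV hW hsubset
    ⟨y, hyU, hyU, lt_of_le_of_ne (hnn y hyU) (Ne.symm hy)⟩ ⟨x, hxU, hxW⟩
  exact hz1.2.ne' (interior_subset hz2).2

theorem setIntegral_ball_eq_circleMean {g : ℂ → ℝ} (hg : Continuous g) (x : ℂ) {R : ℝ}
    (hR : 0 ≤ R) : ∫ y in Metric.ball x R, g y = ∫ r in (0 : ℝ)..R, r * circleMean g x r := by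
  have hpi : -Real.pi ≤ Real.pi := by linarith [Real.pi_pos]
  have h1 : ∫ y in Metric.ball x R, g y =
      ∫ y, (Metric.ball (0 : ℂ) R).indicator (fun y => g (x + y)) y := by
    rw [← integral_indicator Metric.isOpen_ball.measurableSet,
      ← integral_add_left_eq_self (fun y => (Metric.ball x R).indicator g y) x]
    refine integral_congr_ae (Eventually.of_forall fun y => ?_)
    simp [indicator, Metric.mem_ball, dist_eq_norm]
  have hset : Complex.polarCoord.target ∩ {p | p.1 < R} = Ioo 0 R ×ˢ Ioo (-Real.pi) Real.pi := by
    rw [Complex.polarCoord_target]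
    ext p
    simp only [mem_inter_iff, mem_prod, mem_Ioi, mem_Ioo, mem_ofPred_eq]
    tauto
  have hms : MeasurableSet {p : ℝ × ℝ | p.1 < R} := measurableSet_lt measurable_fst measurable_const
  have hcont : Continuous fun p : ℝ × ℝ => p.1 * g (x + p.1 * Complex.exp (p.2 * Complex.I)) := by
    fun_prop
  have h2 : ∫ y, (Metric.ball (0 : ℂ) R).indicator (fun y => g (x + y)) y =
      ∫ p in Ioo 0 R ×ˢ Ioo (-Real.pi) Real.pi,
        p.1 * g (x + p.1 * Complex.exp (p.2 * Complex.I)) := by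
    rw [← Complex.integral_comp_polarCoord_symm, ← hset, ← setIntegral_indicator hms]
    refine setIntegral_congr_fun Complex.polarCoord.open_target.measurableSet fun p hp => ?_
    have hp0 : 0 < p.1 := by
      rw [polarCoord_target] at hp; exact hp.1
    have hsymm : Complex.polarCoord.symm p = p.1 * Complex.exp (p.2 * Complex.I) := by
      rw [Complex.polarCoord_symm_apply, Complex.exp_mul_I]; push_cast; rfl
    simp only [indicator, Metric.mem_ball, dist_zero_right, Complex.norm_polarCoord_symm,
      abs_of_pos hp0, mem_ofPred_eq, smul_eq_mul]
    split_ifs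
    · rw [hsymm]
    · simp
  have hint : IntegrableOn (fun p : ℝ × ℝ => p.1 * g (x + p.1 * Complex.exp (p.2 * Complex.I)))
      (Ioo 0 R ×ˢ Ioo (-Real.pi) Real.pi) (volume.prod volume) := by
    refine (hcont.continuousOn.integrableOn_compact
      (isCompact_Icc.prod isCompact_Icc)).mono_set
      (prod_mono (Ioo_subset_Icc_self (a := (0 : ℝ)) (b := R))
        (Ioo_subset_Icc_self (a := -Real.pi) (b := Real.pi)))
  rw [h1, h2, Measure.volume_eq_prod, setIntegral_prod _ hint, intervalIntegral.integral_of_le hR,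
    ← integral_Ioc_eq_integral_Ioo]
  refine setIntegral_congr_fun measurableSet_Ioc fun r _ => ?_
  simp only
  rw [← integral_Ioc_eq_integral_Ioo, ← intervalIntegral.integral_of_le hpi,
    intervalIntegral.integral_const_mul, circleMean]

/-- A nonnegative subharmonic function on the plane is bounded by its circle means around the
origin. -/
theorem le_of_circleMean_le {g : ℂ → ℝ} (hg : ContDiff ℝ 2 g) (hnn : ∀ y, 0 ≤ g y)
    (hsub : ∀ y, 0 ≤ Δ g y) {x : ℂ} {R B : ℝ} (hR : 0 < R) (hxR : ‖x‖ ≤ R)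
    (hB : ∀ r, 0 < r → r ≤ 2 * R → circleMean g 0 r ≤ B) : g x ≤ B := by
  have hgc := hg.continuous
  have h1 : Real.pi * R ^ 2 * g x ≤ ∫ y in Metric.ball x R, g y := by
    rw [setIntegral_ball_eq_circleMean hgc x hR.le]
    have : ∫ r in (0 : ℝ)..R, r * (2 * Real.pi * g x) = Real.pi * R ^ 2 * g x := by
      rw [intervalIntegral.integral_mul_const, integral_id]; ring
    rw [← this]
    refine intervalIntegral.integral_mono_on_of_le_Ioo hR.le
      (Continuous.intervalIntegrable (by fun_prop) _ _)
      (Continuous.intervalIntegrable (continuous_id.mul (continuous_circleMean hgc x)) _ _)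
      fun r hr => ?_
    exact mul_le_mul_of_nonneg_left (le_circleMean_of_laplacian_nonneg hg (ρ := R + 1)
      (fun y _ => hsub y) hr.1 (by linarith [hr.2])) hr.1.le
  have h2 : ∫ y in Metric.ball x R, g y ≤ ∫ y in Metric.ball 0 (2 * R), g y := by
    refine setIntegral_mono_set ?_ (Eventually.of_forall hnn) (Eventually.of_forall ?_)
    · exact (hgc.continuousOn.integrableOn_compact (isCompact_closedBall (0 : ℂ) (2 * R))).mono_set
        Metric.ball_subset_closedBall
    · refine Metric.ball_subset_ball' ?_
      rw [dist_zero_right]; linarith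
  have h3 : ∫ y in Metric.ball 0 (2 * R), g y ≤ 2 * R ^ 2 * B := by
    rw [setIntegral_ball_eq_circleMean hgc 0 (by linarith)]
    have : ∫ r in (0 : ℝ)..(2 * R), r * B = 2 * R ^ 2 * B := by
      rw [intervalIntegral.integral_mul_const, integral_id]; ring
    rw [← this]
    refine intervalIntegral.integral_mono_on_of_le_Ioo (by linarith)
      (Continuous.intervalIntegrable (continuous_id.mul (continuous_circleMean hgc 0)) _ _)
      (Continuous.intervalIntegrable (by fun_prop) _ _) fun r hr => ?_
    exact mul_le_mul_of_nonneg_left (hB r hr.1 hr.2.le) hr.1.le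
  have hB0 : 0 ≤ B := (circleMean_nonneg fun θ => hnn _).trans (hB (2 * R) (by linarith) le_rfl)
  have h4 : R ^ 2 * (Real.pi * g x) ≤ R ^ 2 * (2 * B) := by linarith
  have h5 := le_of_mul_le_mul_left h4 (by positivity)
  -- The integrals over the two balls give `π * g x ≤ 2 * B`; then `π > 2` suffices.
  nlinarith [Real.pi_gt_three, hnn x]

/-- A nonnegative subharmonic function whose Laplacian decays like `‖y‖⁻³` grows at most
logarithmically. -/
theorem exists_le_log_of_laplacian_le {g : ℂ → ℝ} (hg : ContDiff ℝ 2 g) (hnn : ∀ y, 0 ≤ g y)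
    (hsub : ∀ y, 0 ≤ Δ g y) {K : ℝ} (hK : ∀ y, 1 ≤ ‖y‖ → ‖y‖ ^ 3 * Δ g y ≤ K) :
    ∃ C D : ℝ, 0 ≤ D ∧ ∀ x, g x ≤ C + D * Real.log (1 + ‖x‖) := by
  set A : ℝ → ℝ := fun s => circleMean g 0 (Real.exp s) with hA
  set A₁ : ℝ → ℝ := fun s => Real.exp s * circleFlux g 0 (Real.exp s) with hA₁
  have hmono : ∀ s t, s ≤ t → A s ≤ A t := by
    intro s t hst
    have := monotoneOn_circleMean_exp hg (x := 0) (Real.exp_pos (t + 1)) (fun y _ => hsub y)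
    rw [Real.log_exp] at this
    exact this (show s < t + 1 by linarith) (show t < t + 1 by linarith) hst
  -- For `s ≥ 0` the decay hypothesis gives `A₁' ≤ 2πK exp (-s)`, which is integrable. The added
  -- term absorbs it, so `A₁` is bounded and `A` grows at most linearly in `s = log r`.
  have hd : ∀ s, HasDerivAt (fun s => A₁ s + 2 * Real.pi * K * Real.exp (-s))
      (Real.exp s ^ 2 * circleMean (Δ g) 0 (Real.exp s) - 2 * Real.pi * K * Real.exp (-s)) s := by
    intro s
    have h1 : HasDerivAt (fun s : ℝ => Real.exp (-s)) (-Real.exp (-s)) s := by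
      simpa using (hasDerivAt_neg s).exp
    refine ((hg.hasDerivAt_circleFlux_exp 0 s).add
      (h1.const_mul (2 * Real.pi * K))).congr_deriv ?_
    ring
  have hanti : AntitoneOn (fun s => A₁ s + 2 * Real.pi * K * Real.exp (-s)) (Ici 0) := by
    refine antitoneOn_of_deriv_nonpos (convex_Ici 0)
      (fun s _ => (hd s).continuousAt.continuousWithinAt)
      (fun s _ => (hd s).differentiableAt.differentiableWithinAt) fun s hs => ?_
    rw [interior_Ici] at hs
    rw [(hd s).deriv, sub_nonpos]
    have hmean : circleMean (Δ g) 0 (Real.exp s) ≤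
        circleMean (fun _ => K * Real.exp (-s) ^ 3) 0 (Real.exp s) := by
      refine circleMean_mono hg.continuous_laplacian continuous_const fun θ => ?_
      have hn : ‖(0 : ℂ) + (Real.exp s : ℝ) * Complex.exp (θ * Complex.I)‖ = Real.exp s := by
        rw [zero_add, norm_mul_exp_mul_I (Real.exp_pos s).le]
      have := hK (0 + (Real.exp s : ℝ) * Complex.exp (θ * Complex.I))
        (by rw [hn]; exact Real.one_le_exp hs.le)
      rw [hn] at this
      rw [Real.exp_neg, inv_pow, ← div_eq_mul_inv, le_div_iff₀ (by positivity)]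
      linarith
    rw [circleMean_const] at hmean
    calc Real.exp s ^ 2 * circleMean (Δ g) 0 (Real.exp s)
        ≤ Real.exp s ^ 2 * (2 * Real.pi * (K * Real.exp (-s) ^ 3)) := by gcongr
      _ = 2 * Real.pi * K * Real.exp (-s) := by
        rw [Real.exp_neg]; field_simp
  have hK0 : 0 ≤ K := by
    have := hK 1 (by simp)
    simp only [norm_one, one_pow, one_mul] at this
    exact (hsub 1).trans this
  set D : ℝ := |A₁ 0| + 2 * Real.pi * K with hD
  have hD0 : 0 ≤ D := by positivity
  have hA₁D : ∀ s, 0 ≤ s → A₁ s ≤ D := by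
    intro s hs
    have h := hanti (mem_Ici.2 le_rfl) (mem_Ici.2 hs) hs
    simp only [neg_zero, Real.exp_zero, mul_one] at h
    have : 0 ≤ 2 * Real.pi * K * Real.exp (-s) := by positivity
    linarith [le_abs_self (A₁ 0)]
  have hd2 : ∀ s, HasDerivAt (fun s => A s - D * s) (A₁ s - D) s := by
    intro s
    exact ((hg.hasDerivAt_circleMean_exp 0 s).sub ((hasDerivAt_id s).const_mul D)).congr_deriv
      (by rw [mul_one])
  have hanti2 : AntitoneOn (fun s => A s - D * s) (Ici 0) := by
    refine antitoneOn_of_deriv_nonpos (convex_Ici 0)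
      (fun s _ => (hd2 s).continuousAt.continuousWithinAt)
      (fun s _ => (hd2 s).differentiableAt.differentiableWithinAt) fun s hs => ?_
    rw [interior_Ici] at hs
    rw [(hd2 s).deriv, sub_nonpos]
    exact hA₁D s hs.le
  have hAs : ∀ s, 0 ≤ s → A s ≤ A 0 + D * s := by
    intro s hs
    have h := hanti2 (mem_Ici.2 le_rfl) (mem_Ici.2 hs) hs
    simp only [mul_zero, sub_zero] at h
    linarith
  refine ⟨A 0 + D * Real.log 2, D, hD0, fun x => ?_⟩
  have hx1 : 0 < 1 + ‖x‖ := by positivity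
  have hlog : Real.log (2 * (1 + ‖x‖)) = Real.log 2 + Real.log (1 + ‖x‖) :=
    Real.log_mul (by norm_num) hx1.ne'
  have hlog0 : 0 ≤ Real.log (2 * (1 + ‖x‖)) := Real.log_nonneg (by linarith [norm_nonneg x])
  refine le_of_circleMean_le hg hnn hsub hx1 (by linarith) fun r hr hrR => ?_
  have h1 : circleMean g 0 r = A (Real.log r) := by simp only [hA, Real.exp_log hr]
  rw [h1]
  calc A (Real.log r) ≤ A (Real.log (2 * (1 + ‖x‖))) := hmono _ _ (Real.log_le_log hr hrR)
    _ ≤ A 0 + D * Real.log (2 * (1 + ‖x‖)) := hAs _ hlog0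
    _ = _ := by rw [hlog]; ring

end Subharmonic

/-! ### Explicit Laplacians and elementary inequalities. -/

section

variable {E : Type*} [NormedAddCommGroup E] [InnerProductSpace ℝ E] [FiniteDimensional ℝ E]
  {f g : E → ℝ} {x : E}

theorem laplacian_fun_sub (hf : ContDiffAt ℝ 2 f x) (hg : ContDiffAt ℝ 2 g x) :
    Δ (fun z => f z - g z) x = Δ f x - Δ g x :=
  hf.laplacian_sub hg

theorem laplacian_fun_add (hf : ContDiffAt ℝ 2 f x) (hg : ContDiffAt ℝ 2 g x) :
    Δ (fun z => f z + g z) x = Δ f x + Δ g x :=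
  hf.laplacian_add hg

theorem laplacian_const_mul (c : ℝ) (hf : ContDiffAt ℝ 2 f x) :
    Δ (fun z => c * f z) x = c * Δ f x :=
  InnerProductSpace.laplacian_smul c hf

end

theorem IsLocalMax.laplacian_nonpos {E : Type*} [NormedAddCommGroup E] [InnerProductSpace ℝ E]
    [FiniteDimensional ℝ E] {f : E → ℝ} {x : E} (hm : IsLocalMax f x) (hf : ContDiffAt ℝ 2 f x) :
    Δ f x ≤ 0 := by
  have h := IsLocalMin.laplacian_nonneg (f := -f) hm.neg hf.neg
  rw [InnerProductSpace.laplacian_neg] at h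
  simpa using h

theorem contDiff_norm_sub_sq (c : ℂ) : ContDiff ℝ 2 (fun z : ℂ => ‖z - c‖ ^ 2) :=
  (contDiff_id.sub contDiff_const).norm_sq ℝ

theorem laplacian_norm_sub_sq (c z : ℂ) : Δ (fun z : ℂ => ‖z - c‖ ^ 2) z = 4 := by
  have hsplit : (fun z : ℂ => ‖z - c‖ ^ 2) =
      (fun z : ℂ => (z.re - c.re) ^ 2 * 1) + fun z : ℂ => 1 * (z.im - c.im) ^ 2 := by
    funext z
    rw [Complex.sq_norm, Complex.normSq_apply]
    simp; ring
  have hsq : ∀ a t : ℝ, HasDerivAt (fun t : ℝ => (t - a) ^ 2) (2 * (t - a)) t := fun a t => by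
    exact (((hasDerivAt_id t).sub_const a).pow 2).congr_deriv (by simp)
  have hlin : ∀ a t : ℝ, HasDerivAt (fun t : ℝ => 2 * (t - a)) 2 t := fun a t => by
    simpa using ((hasDerivAt_id t).sub_const a).const_mul 2
  have hone : ∀ t : ℝ, HasDerivAt (fun _ : ℝ => (1 : ℝ)) 0 t := fun t => hasDerivAt_const _ _
  have hzero : ∀ t : ℝ, HasDerivAt (fun _ : ℝ => (0 : ℝ)) 0 t := fun t => hasDerivAt_const _ _
  have hc : ∀ a : ℝ, ContDiff ℝ 2 fun t : ℝ => (t - a) ^ 2 := fun a => by fun_prop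
  have h1c := contDiff_mul_re_im (hc c.re) (contDiff_const (c := (1 : ℝ)))
  have h2c := contDiff_mul_re_im (contDiff_const (c := (1 : ℝ))) (hc c.im)
  rw [hsplit, h1c.contDiffAt.laplacian_add h2c.contDiffAt,
    laplacian_mul_re_im (hc _) contDiff_const (hsq _) (hlin _) hone hzero,
    laplacian_mul_re_im contDiff_const (hc _) hone hzero (hsq _) (hlin _)]
  norm_num

theorem hasDerivAt_exp_const_mul (k t : ℝ) :
    HasDerivAt (fun t => Real.exp (k * t)) (k * Real.exp (k * t)) t := by
  simpa [mul_comm] using ((hasDerivAt_id t).const_mul k).exp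

theorem contDiff_exp_re (k : ℝ) : ContDiff ℝ 2 (fun z : ℂ => Real.exp (k * z.re)) :=
  (contDiff_const.mul Complex.reCLM.contDiff).exp

theorem laplacian_exp_re (k : ℝ) (z : ℂ) :
    Δ (fun z : ℂ => Real.exp (k * z.re)) z = k ^ 2 * Real.exp (k * z.re) := by
  have hone : ∀ t : ℝ, HasDerivAt (fun _ : ℝ => (1 : ℝ)) 0 t := fun t => hasDerivAt_const _ _
  have hzero : ∀ t : ℝ, HasDerivAt (fun _ : ℝ => (0 : ℝ)) 0 t := fun t => hasDerivAt_const _ _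
  have h := laplacian_mul_re_im (φ := fun t => Real.exp (k * t)) (ψ := fun _ => 1) (by fun_prop)
    contDiff_const (hasDerivAt_exp_const_mul k)
    (fun t => (hasDerivAt_exp_const_mul k t).const_mul k) hone hzero z
  simp only [mul_one, mul_zero, add_zero] at h
  rw [h]; ring

theorem eventually_cocompact_norm {P : ℂ → Prop} :
    (∀ᶠ x in cocompact ℂ, P x) ↔ ∃ R : ℝ, ∀ x, R ≤ ‖x‖ → P x := by
  rw [← Metric.cobounded_eq_cocompact, ← comap_norm_atTop, eventually_comap]
  simp only [eventually_atTop]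
  exact ⟨fun ⟨R, h⟩ => ⟨R, fun x hx => h _ hx x rfl⟩,
    fun ⟨R, h⟩ => ⟨R, fun b hb x hx => h x (hx ▸ hb)⟩⟩

/-- The tangent line inequality for `x ↦ x ^ q`, `q ≥ 1`. -/
theorem mul_rpow_mul_sub_le_rpow_sub_rpow {q a b : ℝ} (hq : 1 ≤ q) (ha : 0 ≤ a) (hb : 0 < b) :
    q * b ^ (q - 1) * (a - b) ≤ a ^ q - b ^ q := by
  have h := one_add_mul_self_le_rpow_one_add (s := a / b - 1)
    (by have : 0 ≤ a / b := by positivity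
        linarith) hq
  rw [add_sub_cancel, Real.div_rpow ha hb.le, le_div_iff₀ (by positivity)] at h
  have hbq : b ^ q = b ^ (q - 1) * b := by
    rw [← Real.rpow_add_one hb.ne', sub_add_cancel]
  have : (1 + q * (a / b - 1)) * b ^ q = b ^ q + q * b ^ (q - 1) * (a - b) := by
    rw [hbq]; field_simp
  linarith

/-! ### Solutions in the complex coordinate: decay of `u` and dissipativity. -/

/-- A positive bounded classical solution `(u, w)` of the planar generalized
Schrödinger-Poisson system, in the complex coordinate, with `w → -∞` at infinity. -/
structure IsPositiveSolution (γ p : ℝ) (f : ℝ → ℝ) (u w : ℂ → ℝ) : Prop where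
  gamma_pos : 0 < γ
  two_le : 2 ≤ p
  lip : LocallyLipschitz f
  map_zero : f 0 = 0
  mono : 2 < p → ∃ ε₀ > 0, ∃ a₀ > 0, ∀ s t : ℝ, 0 < s → s < ε₀ → 0 < t → t < ε₀ → s ≠ t →
      (f s - f t) / (s - t) ≤ -a₀
  contDiff_u : ContDiff ℝ 2 u
  contDiff_w : ContDiff ℝ 2 w
  lap_u : ∀ x, Δ u x = -(γ * w x * u x ^ (p - 1)) - f (u x)
  lap_w : ∀ x, Δ w x = -(u x ^ p)
  pos : ∀ x, 0 < u x
  bdd : ∃ M, ∀ x, u x ≤ M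
  tendsto_w : Tendsto w (cocompact ℂ) atBot

namespace IsPositiveSolution

variable {γ p : ℝ} {f : ℝ → ℝ} {u w : ℂ → ℝ}

/-- Allows the moving plane argument to be carried out in one direction only. -/
theorem comp_isometry (h : IsPositiveSolution γ p f u w) (L : ℂ ≃ₗᵢ[ℝ] ℂ) :
    IsPositiveSolution γ p f (fun x => u (L x)) (fun x => w (L x)) where
  gamma_pos := h.gamma_pos
  two_le := h.two_le
  lip := h.lip
  map_zero := h.map_zero
  mono := h.mono
  contDiff_u := h.contDiff_u.comp L.contDiff
  contDiff_w := h.contDiff_w.comp L.contDiff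
  lap_u x := by
    have := laplacian_comp_isometry u L 0 x
    simp only [add_zero] at this
    rw [this, h.lap_u]
  lap_w x := by
    have := laplacian_comp_isometry w L 0 x
    simp only [add_zero] at this
    rw [this, h.lap_w]
  pos x := h.pos _
  bdd := let ⟨M, hM⟩ := h.bdd; ⟨M, fun x => hM _⟩
  tendsto_w := h.tendsto_w.comp L.toHomeomorph.isClosedEmbedding.tendsto_cocompact

theorem exists_w_le (h : IsPositiveSolution γ p f u w) (B : ℝ) :
    ∃ R, ∀ x, R ≤ ‖x‖ → w x ≤ B :=
  eventually_cocompact_norm.1 (h.tendsto_w.eventually (eventually_le_atBot B))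

theorem exists_max_w (h : IsPositiveSolution γ p f u w) : ∃ x₀, ∀ x, w x ≤ w x₀ :=
  h.contDiff_w.continuous.exists_forall_ge h.tendsto_w

theorem exists_lipschitz (h : IsPositiveSolution γ p f u w) (B : ℝ) :
    ∃ L, 0 ≤ L ∧ ∀ s t, 0 ≤ s → s ≤ B → 0 ≤ t → t ≤ B → |f s - f t| ≤ L * |s - t| := by
  obtain ⟨K, hK⟩ := LocallyLipschitzOn.exists_lipschitzOnWith_of_compact
    (isCompact_Icc (a := (0 : ℝ)) (b := B)) (h.lip.locallyLipschitzOn)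
  refine ⟨K, K.2, fun s t hs hsB ht htB => ?_⟩
  have := hK.dist_le_mul s ⟨hs, hsB⟩ t ⟨ht, htB⟩
  rwa [Real.dist_eq, Real.dist_eq] at this

/-- If `u x > δ` far out, then `u - K ‖· - x‖²` has a local maximum `y` in the unit disc, where `Δ u
≤ 4 * K` and `u y ≥ δ`. But there `-γ w u ^ (p - 1)` is huge. Taking `K = M + 1` keeps `y` off the
boundary circle. -/
theorem exists_u_le (h : IsPositiveSolution γ p f u w) {δ : ℝ} (hδ : 0 < δ) :
    ∃ R, ∀ x, R ≤ ‖x‖ → u x ≤ δ := by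
  obtain ⟨M, hM⟩ := h.bdd
  obtain ⟨L, hL0, hL⟩ := h.exists_lipschitz M
  have hM0 : 0 < M := (h.pos 0).trans_le (hM 0)
  have hγ := h.gamma_pos
  set K := M + 1 with hK
  obtain ⟨R, hR⟩ := h.exists_w_le (-(4 * K + L * M + 1) / (γ * δ ^ (p - 1)))
  refine ⟨R + 1, fun x hx => ?_⟩
  by_contra! hux
  set g : ℂ → ℝ := fun z => u z - K * ‖z - x‖ ^ 2 with hg
  have hgc : ContDiff ℝ 2 g := h.contDiff_u.sub (contDiff_const.mul (contDiff_norm_sub_sq x))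
  obtain ⟨y, hyb, hy⟩ := (isCompact_closedBall x 1).exists_isMaxOn
    ⟨x, Metric.mem_closedBall_self zero_le_one⟩ hgc.continuous.continuousOn
  have hgx : δ < g y := by
    have := hy (Metric.mem_closedBall_self (x := x) zero_le_one)
    simp only [mem_ofPred_eq] at this
    refine lt_of_lt_of_le ?_ this
    simpa [hg] using hux
  have hgy : g y = u y - K * ‖y - x‖ ^ 2 := by simp [hg]
  have hyx : ‖y - x‖ < 1 := by
    rw [mem_closedBall_iff_norm] at hyb
    refine lt_of_le_of_ne hyb fun h1 => ?_
    rw [h1] at hgy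
    have := hM y
    linarith
  have hlm : IsLocalMax g y := hy.isLocalMax
    (Filter.mem_of_superset (Metric.isOpen_ball.mem_nhds (mem_ball_iff_norm.2 hyx))
      Metric.ball_subset_closedBall)
  have hlap := hlm.laplacian_nonpos hgc.contDiffAt
  rw [hg, laplacian_fun_sub h.contDiff_u.contDiffAt
    (contDiff_const.mul (contDiff_norm_sub_sq x)).contDiffAt,
    laplacian_const_mul K (contDiff_norm_sub_sq x).contDiffAt, laplacian_norm_sub_sq,
    h.lap_u] at hlap
  have huy : δ ≤ u y := by
    have : 0 ≤ K * ‖y - x‖ ^ 2 := by positivity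
    linarith
  have hwy : w y ≤ -(4 * K + L * M + 1) / (γ * δ ^ (p - 1)) := by
    refine hR y ?_
    have : ‖x‖ ≤ ‖y‖ + ‖y - x‖ := by
      rw [norm_sub_rev]
      simpa using norm_add_le y (x - y)
    linarith
  have hfy : |f (u y)| ≤ L * M := by
    have := hL (u y) 0 (h.pos y).le (hM y) le_rfl hM0.le
    rw [h.map_zero, sub_zero, sub_zero, abs_of_pos (h.pos y)] at this
    exact this.trans (mul_le_mul_of_nonneg_left (hM y) hL0)
  have hδp : 0 < δ ^ (p - 1) := by positivity
  have hup : δ ^ (p - 1) ≤ u y ^ (p - 1) :=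
    Real.rpow_le_rpow hδ.le huy (by linarith [h.two_le])
  rw [le_div_iff₀ (by positivity)] at hwy
  have hneg : w y ≤ 0 := by
    by_contra! hpos
    have : 0 < w y * (γ * δ ^ (p - 1)) := by positivity
    have : 0 ≤ L * M := by positivity
    linarith
  have : γ * w y * u y ^ (p - 1) ≤ γ * w y * δ ^ (p - 1) :=
    mul_le_mul_of_nonpos_left hup (mul_nonpos_of_nonneg_of_nonpos hγ.le hneg)
  linarith [neg_abs_le (f (u y)), le_abs_self (f (u y))]

/-- Near infinity, the nonlinearity is uniformly dissipative for small values of `u`. -/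
theorem exists_dissipative (h : IsPositiveSolution γ p f u w) :
    ∃ ε > 0, ∃ a > 0, ∃ R, ∀ x, R ≤ ‖x‖ → ∀ s t, 0 ≤ s → s < t → t < ε →
      a * (t - s) ≤ γ * w x * (s ^ (p - 1) - t ^ (p - 1)) + (f s - f t) := by
  have hγ := h.gamma_pos
  suffices H : ∃ ε > 0, ∃ a > 0, ∃ R, ∀ x, R ≤ ‖x‖ → ∀ s t, 0 < s → s < t → t < ε →
      a * (t - s) ≤ γ * w x * (s ^ (p - 1) - t ^ (p - 1)) + (f s - f t) by
    obtain ⟨ε, hε, a, ha, R, hR⟩ := H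
    refine ⟨ε, hε, a, ha, R, fun x hx s t hs hst ht => ?_⟩
    -- The endpoint `s = 0`, reached by continuity, is what later gives the exponential decay of
    -- `u`.
    rcases hs.lt_or_eq with hs | rfl
    · exact hR x hx s t hs hst ht
    have hcont : Continuous fun s : ℝ =>
        γ * w x * (s ^ (p - 1) - t ^ (p - 1)) + (f s - f t) - a * (t - s) := by
      have h1 : Continuous fun s : ℝ => s ^ (p - 1) :=
        Real.continuous_rpow_const (by linarith [h.two_le])
      have h2 := h.lip.continuous
      fun_prop
    have hlim := (hcont.tendsto 0).mono_left (nhdsWithin_le_nhds (s := Ioi 0))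
    have := ge_of_tendsto hlim (b := 0) (by
      filter_upwards [self_mem_nhdsWithin, nhdsWithin_le_nhds (eventually_lt_nhds hst)] with s h1 h2
      exact sub_nonneg.2 (hR x hx s t h1 h2 ht))
    exact sub_nonneg.1 this
  -- For `p > 2` the power term contributes only its sign and the hypothesis on `f` supplies the
  -- linear gain. For `p = 2` the power is linear, and a very negative `w` absorbs the Lipschitz
  -- constant of `f`.
  rcases h.two_le.lt_or_eq with hp | hp
  · obtain ⟨ε, hε, a, ha, hmono⟩ := h.mono hp
    obtain ⟨R, hR⟩ := h.exists_w_le 0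
    refine ⟨ε, hε, a, ha, R, fun x hx s t hs hst ht => ?_⟩
    have h1 : 0 ≤ γ * w x * (s ^ (p - 1) - t ^ (p - 1)) := by
      refine mul_nonneg_of_nonpos_of_nonpos (mul_nonpos_of_nonneg_of_nonpos hγ.le (hR x hx)) ?_
      exact sub_nonpos.2 (Real.rpow_le_rpow hs.le hst.le (by linarith))
    have h2 := hmono s t hs (hst.trans ht) (hs.trans hst) ht hst.ne
    rw [div_le_iff_of_neg (by linarith)] at h2
    linarith
  · obtain ⟨L, hL0, hL⟩ := h.exists_lipschitz 1
    obtain ⟨R, hR⟩ := h.exists_w_le (-(L + 1) / γ)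
    refine ⟨1, one_pos, 1, one_pos, R, fun x hx s t hs hst ht => ?_⟩
    have h1 := hR x hx
    rw [le_div_iff₀ hγ] at h1
    have h2 := hL s t hs.le (by linarith) (by linarith) ht.le
    rw [abs_sub_comm s t, abs_of_pos (sub_pos.2 hst)] at h2
    have h3 : (2 : ℝ) - 1 = 1 := by norm_num
    rw [← hp, h3, Real.rpow_one, Real.rpow_one]
    nlinarith [neg_abs_le (f s - f t)]

end IsPositiveSolution

/-! ### Exponential decay of `u` and logarithmic control of `w`. -/

/-- Comparison with an exponential on a half plane. -/
theorem le_exp_re_of_laplacian_ge {u : ℂ → ℝ} (hu : ContDiff ℝ 2 u) {c M R : ℝ} (hc : 0 < c)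
    (hM0 : 0 ≤ M) (hM : ∀ x, u x ≤ M) (hlap : ∀ x, R ≤ ‖x‖ → c ^ 2 * u x ≤ Δ u x)
    (h0 : ∀ δ > 0, ∃ R', ∀ x, R' ≤ ‖x‖ → u x ≤ δ) (x : ℂ) :
    u x ≤ M * Real.exp (c * R) * Real.exp (-c * x.re) := by
  by_contra! hx
  set C := M * Real.exp (c * R) with hC
  have hC0 : 0 ≤ C := by positivity
  set g : ℂ → ℝ := fun z => C * Real.exp (-c * z.re) - u z with hg
  have hgc : ContDiff ℝ 2 g := (contDiff_const.mul (contDiff_exp_re (-c))).sub hu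
  have hgz : ∀ z, g z = C * Real.exp (-c * z.re) - u z := fun z => by simp [hg]
  have hgx : g x < 0 := by rw [hgz]; linarith
  -- Where `re z ≤ R` the exponential is at least `M`, so the differential inequality is needed only
  -- where it is available.
  have hre : ∀ z, g z < 0 → R < z.re := by
    intro z hz
    by_contra! hzR
    have : M ≤ C * Real.exp (-c * z.re) := by
      rw [hC, mul_assoc, ← Real.exp_add]
      refine le_mul_of_one_le_right hM0 (Real.one_le_exp ?_)
      nlinarith
    rw [hgz] at hz
    linarith [hM z]
  obtain ⟨R', hR'⟩ := h0 (-g x) (by linarith)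
  obtain ⟨y, hy⟩ := hgc.continuous.exists_forall_le' x (by
    rw [eventually_cocompact_norm]
    refine ⟨R', fun z hz => ?_⟩
    have : 0 ≤ C * Real.exp (-c * z.re) := by positivity
    rw [hgz z]
    linarith [hR' z hz])
  have hgy : g y < 0 := (hy x).trans_lt hgx
  have hmin : IsLocalMin g y := Eventually.of_forall hy
  have hl := hmin.laplacian_nonneg hgc.contDiffAt
  rw [hg, laplacian_fun_sub (contDiff_const.mul (contDiff_exp_re (-c))).contDiffAt hu.contDiffAt,
    laplacian_const_mul C (contDiff_exp_re (-c)).contDiffAt, laplacian_exp_re] at hl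
  have h1 := hlap y ((hre y hgy).le.trans (Complex.re_le_norm y))
  rw [hgz] at hgy
  have hc2 : 0 < c ^ 2 := by positivity
  nlinarith

namespace IsPositiveSolution

variable {γ p : ℝ} {f : ℝ → ℝ} {u w : ℂ → ℝ}

/-- Dissipativity at `s = 0` gives `Δ u ≥ a * u` outside a ball. The half-plane comparison is
applied after rotating `x` onto the positive real axis; its constants do not depend on the rotation.
-/
theorem exists_le_exp_norm (h : IsPositiveSolution γ p f u w) :
    ∃ C > 0, ∃ c > 0, ∀ x, u x ≤ C * Real.exp (-c * ‖x‖) := by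
  obtain ⟨M, hM⟩ := h.bdd
  have hM0 : 0 < M := (h.pos 0).trans_le (hM 0)
  obtain ⟨ε, hε, a, ha, R₁, hR₁⟩ := h.exists_dissipative
  obtain ⟨R₂, hR₂⟩ := h.exists_u_le (half_pos hε)
  have hlap : ∀ x, max R₁ R₂ ≤ ‖x‖ → √a ^ 2 * u x ≤ Δ u x := by
    intro x hx
    have h1 := hR₁ x ((le_max_left _ _).trans hx) 0 (u x) le_rfl (h.pos x)
      (by linarith [hR₂ x ((le_max_right _ _).trans hx)])
    rw [Real.zero_rpow (by linarith [h.two_le]), h.map_zero] at h1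
    rw [Real.sq_sqrt ha.le, h.lap_u]
    linarith
  refine ⟨M * Real.exp (√a * max R₁ R₂), by positivity, √a, by positivity, fun x => ?_⟩
  obtain ⟨L, hL⟩ : ∃ L : ℂ ≃ₗᵢ[ℝ] ℂ, L (‖x‖ : ℂ) = x := by
    rcases eq_or_ne x 0 with rfl | hx
    · exact ⟨LinearIsometryEquiv.refl ℝ ℂ, by simp⟩
    · refine ⟨rotation (Circle.exp x.arg), ?_⟩
      rw [rotation_apply, Circle.coe_exp, mul_comm, Complex.norm_mul_exp_arg_mul_I]
  have key := le_exp_re_of_laplacian_ge (h.comp_isometry L).contDiff_u (c := √a) (M := M)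
    (R := max R₁ R₂) (by positivity) hM0.le (fun x => hM _) (fun y hy => by
      have := laplacian_comp_isometry u L 0 y
      simp only [add_zero] at this
      rw [this]
      exact hlap _ (by rwa [L.norm_map]))
    (fun δ hδ => by
      obtain ⟨R', hR'⟩ := h.exists_u_le hδ
      exact ⟨R', fun y hy => hR' _ (by rwa [L.norm_map])⟩) (‖x‖ : ℂ)
  simpa [hL] using key

/-- `w` is bounded above and decreases at most logarithmically. -/
theorem exists_log_le_w (h : IsPositiveSolution γ p f u w) :
    ∃ B C D, 0 ≤ D ∧ (∀ x, w x ≤ B) ∧ ∀ x, C - D * Real.log (1 + ‖x‖) ≤ w x := by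
  obtain ⟨x₀, hx₀⟩ := h.exists_max_w
  obtain ⟨C, hC, c, hc, hu⟩ := h.exists_le_exp_norm
  have hp := h.two_le
  have hgc : ContDiff ℝ 2 (fun z => w x₀ - w z) := contDiff_const.sub h.contDiff_w
  have hgl : ∀ y, Δ (fun z => w x₀ - w z) y = u y ^ p := by
    intro y
    rw [laplacian_fun_sub contDiffAt_const h.contDiff_w.contDiffAt, h.lap_w,
      InnerProductSpace.laplacian_const]
    simp
  -- `w x₀ - w` is nonnegative with Laplacian `u ^ p`; the cubic decay follows from `exp t ≥ t ^ 3 /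
  -- 6`.
  have hK : ∀ y : ℂ, 1 ≤ ‖y‖ → ‖y‖ ^ 3 * Δ (fun z => w x₀ - w z) y ≤ C ^ p * (6 / (c * p) ^ 3) := by
    intro y _
    rw [hgl]
    have h1 : u y ^ p ≤ C ^ p * Real.exp (-(c * p * ‖y‖)) := by
      refine (Real.rpow_le_rpow (h.pos y).le (hu y) (by linarith)).trans_eq ?_
      rw [Real.mul_rpow hC.le (Real.exp_pos _).le, ← Real.exp_mul]
      congr 2; ring
    have hcp : 0 < c * p := by positivity
    have h2 : (c * p * ‖y‖) ^ 3 / 6 ≤ Real.exp (c * p * ‖y‖) := by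
      have := Real.pow_div_factorial_le_exp (c * p * ‖y‖) (by positivity) 3
      simpa [Nat.factorial] using this
    have h3 : ‖y‖ ^ 3 * Real.exp (-(c * p * ‖y‖)) ≤ 6 / (c * p) ^ 3 := by
      rw [Real.exp_neg, ← div_eq_mul_inv, div_le_div_iff₀ (Real.exp_pos _) (by positivity)]
      nlinarith
    calc ‖y‖ ^ 3 * u y ^ p ≤ ‖y‖ ^ 3 * (C ^ p * Real.exp (-(c * p * ‖y‖))) := by gcongr
      _ = C ^ p * (‖y‖ ^ 3 * Real.exp (-(c * p * ‖y‖))) := by ring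
      _ ≤ C ^ p * (6 / (c * p) ^ 3) := by gcongr
  obtain ⟨C', D, hD, hbound⟩ := exists_le_log_of_laplacian_le hgc
    (fun y => sub_nonneg.2 (hx₀ y)) (fun y => by
      rw [hgl]; exact Real.rpow_nonneg (h.pos y).le p) hK
  refine ⟨w x₀, w x₀ - C', D, hD, hx₀, fun x => ?_⟩
  have := hbound x
  linarith

end IsPositiveSolution

/-! ### Reflections in vertical lines and reflected differences. -/

/-- Reflection of the complex plane in the vertical line `re = l`. -/
noncomputable def reflectRe (l : ℝ) (x : ℂ) : ℂ := 2 * l - (starRingEnd ℂ) x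

section reflectRe

@[simp] theorem reflectRe_re (l : ℝ) (x : ℂ) : (reflectRe l x).re = 2 * l - x.re := by
  simp [reflectRe]

@[simp] theorem reflectRe_im (l : ℝ) (x : ℂ) : (reflectRe l x).im = x.im := by
  simp [reflectRe]

@[simp] theorem reflectRe_reflectRe (l : ℝ) (x : ℂ) : reflectRe l (reflectRe l x) = x := by
  apply Complex.ext <;> simp

theorem reflectRe_of_re_eq {l : ℝ} {x : ℂ} (h : x.re = l) : reflectRe l x = x := by
  apply Complex.ext <;> simp [h]
  ring

theorem continuous_reflectRe : Continuous fun q : ℝ × ℂ => reflectRe q.1 q.2 := by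
  unfold reflectRe
  fun_prop

theorem contDiff_reflectRe (l : ℝ) : ContDiff ℝ 2 (reflectRe l) :=
  contDiff_const.sub Complex.conjCLE.contDiff

theorem laplacian_comp_reflectRe (u : ℂ → ℝ) (l : ℝ) (x : ℂ) :
    Δ (fun y => u (reflectRe l y)) x = Δ u (reflectRe l x) := by
  have h := laplacian_comp_isometry u (Complex.conjLIE.trans (LinearIsometryEquiv.neg ℝ)) (2 * l) x
  have e : ∀ y, (Complex.conjLIE.trans (LinearIsometryEquiv.neg ℝ)) y + 2 * l = reflectRe l y := by
    intro y
    simp [reflectRe]; ring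
  simpa only [e] using h

theorem norm_reflectRe_le (l : ℝ) (x : ℂ) : ‖reflectRe l x‖ ≤ 2 * |l| + ‖x‖ := by
  refine (norm_sub_le _ _).trans ?_
  simp

/-- The difference between the reflected function and the function. -/
noncomputable def reflDiff (u : ℂ → ℝ) (l : ℝ) (x : ℂ) : ℝ := u (reflectRe l x) - u x

theorem reflDiff_of_re_eq (u : ℂ → ℝ) {l : ℝ} {x : ℂ} (h : x.re = l) : reflDiff u l x = 0 := by
  rw [reflDiff, reflectRe_of_re_eq h, sub_self]

variable {u : ℂ → ℝ}

theorem contDiff_reflDiff (hu : ContDiff ℝ 2 u) (l : ℝ) : ContDiff ℝ 2 (reflDiff u l) :=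
  (hu.comp (contDiff_reflectRe l)).sub hu

theorem laplacian_reflDiff (hu : ContDiff ℝ 2 u) (l : ℝ) (x : ℂ) :
    Δ (reflDiff u l) x = Δ u (reflectRe l x) - Δ u x := by
  have := laplacian_fun_sub (hu.comp (contDiff_reflectRe l)).contDiffAt (hu.contDiffAt (x := x))
  rw [← laplacian_comp_reflectRe]
  exact this

theorem continuous_reflDiff (hu : Continuous u) :
    Continuous fun q : ℝ × ℂ => reflDiff u q.1 q.2 :=
  (hu.comp continuous_reflectRe).sub (hu.comp continuous_snd)

theorem hasDerivAt_reflDiff (hu : Differentiable ℝ u) (l : ℝ) (x : ℂ) :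
    HasDerivAt (fun t : ℝ => reflDiff u l (x + t))
      (-fderiv ℝ u (reflectRe l x) 1 - fderiv ℝ u x 1) 0 := by
  have h1 : HasDerivAt (fun t : ℝ => reflectRe l (x + t)) (-1) 0 := by
    have : (fun t : ℝ => reflectRe l (x + t)) = fun t : ℝ => reflectRe l x - t := by
      funext t
      simp [reflectRe]; ring
    rw [this]
    exact (Complex.ofRealCLM.hasDerivAt (x := (0 : ℝ))).const_sub _
  have h2 : HasDerivAt (fun t : ℝ => x + t) 1 0 :=
    (Complex.ofRealCLM.hasDerivAt (x := (0 : ℝ))).const_add _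
  have h3 := (hu (reflectRe l (x + (0 : ℝ)))).hasFDerivAt.comp_hasDerivAt 0 h1
  have h4 := (hu (x + (0 : ℝ))).hasFDerivAt.comp_hasDerivAt 0 h2
  refine (h3.sub h4).congr_deriv ?_
  simp

theorem isOpen_lt_re (l : ℝ) : IsOpen {x : ℂ | l < x.re} :=
  isOpen_lt continuous_const Complex.continuous_re

theorem isClosed_le_re (l : ℝ) : IsClosed {x : ℂ | l ≤ x.re} :=
  isClosed_le continuous_const Complex.continuous_re

theorem isLocalMin_of_forall_lt_re {g : ℂ → ℝ} {l : ℝ} {x : ℂ} (hx : l < x.re)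
    (h : ∀ y : ℂ, l < y.re → g x ≤ g y) : IsLocalMin g x :=
  Filter.mem_of_superset ((isOpen_lt_re l).mem_nhds hx) h

end reflectRe

/-- Lets any positive multiple of the square-root barrier dominate the logarithmic fall of `w` at
infinity. -/
theorem eventually_log_le_sqrt {A D E ε : ℝ} (hD : 0 ≤ D) (hε : 0 < ε) :
    ∀ᶠ r in atTop, D * Real.log (A + r) + E ≤ ε * √r := by
  have h1 : (fun r : ℝ => D * Real.log r + (D * Real.log 2 + E)) =o[atTop]
      fun r => r ^ (1 / 2 : ℝ) := by
    refine Asymptotics.IsLittleO.add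
      ((isLittleO_log_rpow_atTop (by norm_num)).const_mul_left D) ?_
    exact Asymptotics.isLittleO_const_left.2 (Or.inr
      (tendsto_norm_atTop_atTop.comp (tendsto_rpow_atTop (by norm_num))))
  filter_upwards [h1.bound hε, eventually_ge_atTop A, eventually_ge_atTop 1,
    eventually_gt_atTop (-A)] with r hr hA h0 hA'
  rw [← Real.sqrt_eq_rpow, Real.norm_of_nonneg (Real.sqrt_nonneg r)] at hr
  have h2 : Real.log (A + r) ≤ Real.log 2 + Real.log r := by
    rw [← Real.log_mul (by norm_num) (by linarith)]
    exact Real.log_le_log (by linarith) (by linarith)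
  have h3 := (Real.le_norm_self _).trans hr
  nlinarith

/-! ### Maximum principles for the reflected differences; start of the moving planes. -/

namespace IsPositiveSolution

variable {γ p : ℝ} {f : ℝ → ℝ} {u w : ℂ → ℝ}

theorem exists_rpow_le_exp_re (h : IsPositiveSolution γ p f u w) :
    ∃ K > 0, ∃ c > 0, ∀ x, u x ^ (p - 1) ≤ K * Real.exp (-c * x.re) := by
  obtain ⟨C, hC, c, hc, hu⟩ := h.exists_le_exp_norm
  have hp : 0 < p - 1 := by linarith [h.two_le]
  refine ⟨C ^ (p - 1), by positivity, c * (p - 1), by positivity, fun x => ?_⟩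
  refine (Real.rpow_le_rpow (h.pos x).le (hu x) hp.le).trans ?_
  rw [Real.mul_rpow hC.le (Real.exp_pos _).le, ← Real.exp_mul]
  refine mul_le_mul_of_nonneg_left (Real.exp_le_exp.2 ?_) (by positivity)
  have := Complex.re_le_norm x
  have : 0 ≤ c * (p - 1) * (‖x‖ - x.re) := mul_nonneg (by positivity) (by linarith)
  linarith

theorem laplacian_reflDiff_w (h : IsPositiveSolution γ p f u w) (l : ℝ) (x : ℂ) :
    Δ (reflDiff w l) x = u x ^ p - u (reflectRe l x) ^ p := by
  rw [laplacian_reflDiff h.contDiff_w, h.lap_w, h.lap_w]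
  ring

/-- Grouped so that the coupling to `w` is separated from the bracket estimated by
`exists_dissipative`. -/
theorem laplacian_reflDiff_u (h : IsPositiveSolution γ p f u w) (l : ℝ) (x : ℂ) :
    Δ (reflDiff u l) x = -(γ * reflDiff w l x * u (reflectRe l x) ^ (p - 1)) -
      (γ * w x * (u (reflectRe l x) ^ (p - 1) - u x ^ (p - 1)) +
        (f (u (reflectRe l x)) - f (u x))) := by
  rw [laplacian_reflDiff h.contDiff_u, h.lap_u, h.lap_u, reflDiff]
  ring

/-- A lower bound for the reflected difference of `u` gives one for that of `w`. -/
theorem neg_mul_le_reflDiff_w (h : IsPositiveSolution γ p f u w) {K c : ℝ} (hK0 : 0 < K)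
    (hc : 0 < c) (hK : ∀ x, u x ^ (p - 1) ≤ K * Real.exp (-c * x.re)) {l V : ℝ} (hV : 0 ≤ V)
    (hv : ∀ x : ℂ, l < x.re → -V ≤ reflDiff u l x) (x : ℂ) (hx : l < x.re) :
    -(V * (p * K / c ^ 2 * Real.exp (-c * l))) ≤ reflDiff w l x := by
  obtain ⟨B, C, D, hD, hwB, hwC⟩ := h.exists_log_le_w
  have hp := h.two_le
  set k := p * K / c ^ 2 with hk
  have hk0 : 0 < k := by positivity
  set E : ℂ → ℝ := fun z => Real.exp (-c * z.re) with hE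
  have hEc : ContDiff ℝ 2 E := contDiff_exp_re (-c)
  -- The choice of `k` gives `Δ (k * E) = p * K * E`, which dominates the source `p * u ^ (p - 1)`;
  -- the constant makes the bracket zero on the line and nonnegative to its right. The term `ε *
  -- reSqrt`, shifted by `1` off its slit, controls infinity, and `V + ε` makes the inequality
  -- strict even for `V = 0`.
  suffices H : ∀ ε > 0, ∀ y : ℂ, l < y.re →
      0 ≤ reflDiff w l y + (V + ε) * (k * Real.exp (-c * l) - k * E y) +
        ε * reSqrt (y - (l - 1 : ℝ)) by
    have hcont : Continuous fun ε : ℝ =>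
        reflDiff w l x + (V + ε) * (k * Real.exp (-c * l) - k * E x) +
          ε * reSqrt (x - (l - 1 : ℝ)) := by fun_prop
    have hlim := (hcont.tendsto 0).mono_left (nhdsWithin_le_nhds (s := Ioi 0))
    have := ge_of_tendsto hlim (b := 0) (by
      filter_upwards [self_mem_nhdsWithin] with ε hε using H ε hε x hx)
    have hE0 : 0 ≤ V * (k * E x) := by positivity
    linarith
  intro ε hε y hy
  by_contra! hneg
  set b : ℂ → ℝ := fun z => reSqrt (z - (l - 1 : ℝ)) with hb
  set q : ℂ → ℝ := fun z => reflDiff w l z + (V + ε) * (k * Real.exp (-c * l) - k * E z) +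
        ε * b z with hq
  have hslit : ∀ z : ℂ, l ≤ z.re → 0 < (z - (l - 1 : ℝ)).re := by
    intro z hz
    simp only [Complex.sub_re, Complex.ofReal_re]
    linarith
  have hbc : ∀ z : ℂ, l ≤ z.re → ContDiffAt ℝ 2 b z := by
    intro z hz
    exact ContDiffAt.comp (g := reSqrt) z (contDiffAt_reSqrt (Or.inl (hslit z hz)))
      (contDiffAt_id.sub contDiffAt_const)
  have hbΔ : ∀ z : ℂ, l ≤ z.re → Δ b z = 0 := by
    intro z hz
    have := laplacian_comp_isometry reSqrt (LinearIsometryEquiv.refl ℝ ℂ) (-(l - 1 : ℝ)) z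
    simp only [LinearIsometryEquiv.coe_refl, id, ← sub_eq_add_neg] at this
    rw [hb, this]
    exact laplacian_reSqrt (Or.inl (hslit z hz))
  have hbnn : ∀ z : ℂ, l ≤ z.re → √‖z - (l - 1 : ℝ)‖ / 2 ≤ b z := fun z hz =>
    reSqrt_ge (hslit z hz)
  have hzc := contDiff_reflDiff h.contDiff_w l
  have hhc : ContDiff ℝ 2 fun z => k * Real.exp (-c * l) - k * E z :=
    contDiff_const.sub (contDiff_const.mul hEc)
  have hqc : ∀ z : ℂ, l ≤ z.re → ContDiffAt ℝ 2 q z := fun z hz =>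
    (hzc.contDiffAt.add (contDiff_const.mul hhc).contDiffAt).add
      (contDiffAt_const.mul (hbc z hz))
  have hhnn : ∀ z : ℂ, l ≤ z.re → 0 ≤ k * Real.exp (-c * l) - k * E z := by
    intro z hz
    rw [sub_nonneg]
    refine mul_le_mul_of_nonneg_left (Real.exp_le_exp.2 ?_) hk0.le
    nlinarith
  have hinf : ∀ᶠ z in cocompact ℂ ⊓ 𝓟 {z : ℂ | l ≤ z.re}, q y ≤ q z := by
    rw [eventually_inf_principal, eventually_cocompact_norm]
    obtain ⟨R, hR⟩ := eventually_atTop.1 (eventually_log_le_sqrt (A := 1 + 2 * |l| + |l - 1|)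
      (E := B - C) hD (half_pos hε))
    refine ⟨R + |l - 1|, fun z hz hzl => hneg.le.trans ?_⟩
    set r := ‖z - (l - 1 : ℝ)‖ with hr
    have hn1 : ‖z‖ ≤ r + |l - 1| := by
      have := norm_add_le (z - (l - 1 : ℝ)) ((l - 1 : ℝ) : ℂ)
      rwa [sub_add_cancel, Complex.norm_real, Real.norm_eq_abs] at this
    have h1 := hR r (by linarith)
    have h2 := hwC (reflectRe l z)
    have h3 : Real.log (1 + ‖reflectRe l z‖) ≤ Real.log (1 + 2 * |l| + |l - 1| + r) := by
      refine Real.log_le_log (by positivity) ?_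
      linarith [norm_reflectRe_le l z]
    have h4 := mul_le_mul_of_nonneg_left h3 hD
    have h5 := mul_le_mul_of_nonneg_left (hbnn z hzl) hε.le
    have h6 := mul_nonneg (by linarith : 0 ≤ V + ε) (hhnn z hzl)
    have h7 := hwB z
    simp only [hq, reflDiff]
    linarith
  obtain ⟨a, hal, ha⟩ := ContinuousOn.exists_isMinOn'
    (fun z hz => (hqc z hz).continuousAt.continuousWithinAt) (isClosed_le_re l) hy.le hinf
  have hqa : q a < 0 := lt_of_le_of_lt (ha (show l ≤ y.re from hy.le)) hneg
  have hal' : l < a.re := by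
    refine lt_of_le_of_ne hal fun heq => ?_
    have h1 := reflDiff_of_re_eq w heq.symm
    have h2 := mul_nonneg (by linarith : 0 ≤ V + ε) (hhnn a hal)
    have h3 : 0 ≤ ε * b a := mul_nonneg hε.le ((by positivity : (0 : ℝ) ≤ _).trans (hbnn a hal))
    simp only [hq, h1] at hqa
    linarith
  have hmin := isLocalMin_of_forall_lt_re hal' fun z hz => ha (show l ≤ z.re from le_of_lt hz)
  have hl := hmin.laplacian_nonneg (hqc a hal)
  rw [hq, laplacian_fun_add (hzc.contDiffAt.add (contDiff_const.mul hhc).contDiffAt)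
      (contDiffAt_const.mul (hbc a hal)),
    laplacian_fun_add hzc.contDiffAt (contDiff_const.mul hhc).contDiffAt,
    laplacian_const_mul _ hhc.contDiffAt, laplacian_const_mul _ (hbc a hal), hbΔ a hal,
    laplacian_fun_sub contDiffAt_const (contDiff_const.mul hEc).contDiffAt,
    laplacian_const_mul _ hEc.contDiffAt, laplacian_exp_re, InnerProductSpace.laplacian_const,
    h.laplacian_reflDiff_w] at hl
  have h1 := mul_rpow_mul_sub_le_rpow_sub_rpow (q := p) (by linarith) (h.pos (reflectRe l a)).le
    (h.pos a)
  have h2 := hv a hal'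
  rw [reflDiff] at h2
  have hup : 0 ≤ u a ^ (p - 1) := Real.rpow_nonneg (h.pos a).le _
  have h3 : u a ^ p - u (reflectRe l a) ^ p ≤ p * u a ^ (p - 1) * V := by
    have : p * u a ^ (p - 1) * (-V) ≤ p * u a ^ (p - 1) * (u (reflectRe l a) - u a) :=
      mul_le_mul_of_nonneg_left h2 (by positivity)
    linarith
  have h4 : p * u a ^ (p - 1) * V ≤ p * (K * Real.exp (-c * a.re)) * V := by
    have := hK a
    gcongr
  have h5 : (V + ε) * ((0 : ℂ → ℝ) a - k * ((-c) ^ 2 * Real.exp (-c * a.re))) =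
      -(p * (K * Real.exp (-c * a.re)) * V) - p * K * Real.exp (-c * a.re) * ε := by
    rw [hk]
    simp only [Pi.zero_apply]
    field_simp
    ring
  have h6 : 0 < p * K * Real.exp (-c * a.re) * ε := by positivity
  linarith

/-- Both reflected differences are nonnegative on the half plane to the right of `re = l`. -/
def Good (u w : ℂ → ℝ) (l : ℝ) : Prop :=
  ∀ x : ℂ, l < x.re → 0 ≤ reflDiff u l x ∧ 0 ≤ reflDiff w l x

/-- The case `V = 0` of the preceding bound: only the sign of the difference of `u` has to be
tracked. -/
theorem good_of_reflDiff_u_nonneg (h : IsPositiveSolution γ p f u w) {l : ℝ}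
    (hv : ∀ x : ℂ, l < x.re → 0 ≤ reflDiff u l x) : Good u w l := by
  obtain ⟨K, hK0, c, hc, hK⟩ := h.exists_rpow_le_exp_re
  refine fun x hx => ⟨hv x hx, ?_⟩
  simpa using h.neg_mul_le_reflDiff_w hK0 hc hK le_rfl (by simpa using hv) x hx

/-- Negative minima of the reflected difference of `u` stay in a bounded region. -/
theorem exists_norm_lt_of_isMin (h : IsPositiveSolution γ p f u w) (Λ : ℝ) :
    ∃ R, ∀ l, Λ ≤ l → ∀ x : ℂ, l < x.re → reflDiff u l x < 0 →
      (∀ y : ℂ, l < y.re → reflDiff u l x ≤ reflDiff u l y) → ‖x‖ < R := by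
  obtain ⟨K, hK0, c, hc, hK⟩ := h.exists_rpow_le_exp_re
  obtain ⟨ε, hε, a, ha, R₁, hR₁⟩ := h.exists_dissipative
  have hp := h.two_le
  have hp1 : 0 < p - 1 := by linarith
  have hγ := h.gamma_pos
  set H := p * K / c ^ 2 * Real.exp (-c * Λ) with hH
  have hH0 : 0 < H := by positivity
  -- Once `u ≤ δ`, the coupling term consumes at most half of the dissipation `a * (t - s)`. The
  -- bound `H` serves all `l ≥ Λ`, so the radius is uniform in `l`.
  set δ := (a / (2 * γ * H)) ^ (p - 1)⁻¹ with hδ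
  have hδ0 : 0 < δ := by positivity
  have hδp : δ ^ (p - 1) = a / (2 * γ * H) := Real.rpow_inv_rpow (by positivity) hp1.ne'
  obtain ⟨R₂, hR₂⟩ := h.exists_u_le (half_pos hε)
  obtain ⟨R₃, hR₃⟩ := h.exists_u_le hδ0
  refine ⟨max R₁ (max R₂ R₃), fun l hl x hx hneg hmin => ?_⟩
  by_contra! hR
  have hx1 : R₁ ≤ ‖x‖ := (le_max_left _ _).trans hR
  have hx2 : R₂ ≤ ‖x‖ := ((le_max_left _ _).trans (le_max_right _ _)).trans hR
  have hx3 : R₃ ≤ ‖x‖ := ((le_max_right _ _).trans (le_max_right _ _)).trans hR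
  have hlap := (isLocalMin_of_forall_lt_re hx hmin).laplacian_nonneg
    (contDiff_reflDiff h.contDiff_u l).contDiffAt
  rw [h.laplacian_reflDiff_u] at hlap
  have hz := h.neg_mul_le_reflDiff_w hK0 hc hK (V := -reflDiff u l x) (by linarith)
    (fun y hy => by simpa using hmin y hy) x hx
  have hHl : p * K / c ^ 2 * Real.exp (-c * l) ≤ H := by
    refine mul_le_mul_of_nonneg_left (Real.exp_le_exp.2 ?_) (by positivity)
    nlinarith
  set s := u (reflectRe l x) with hs
  set t := u x with ht
  have hst : reflDiff u l x = s - t := rfl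
  rw [hst] at hneg hz
  have hs0 : 0 < s := h.pos _
  have h1 := hR₁ x hx1 s t hs0.le (by linarith) (by linarith [hR₂ x hx2])
  have h2 : s ^ (p - 1) ≤ a / (2 * γ * H) := by
    rw [← hδp]
    exact Real.rpow_le_rpow hs0.le (by linarith [hR₃ x hx3]) hp1.le
  have h3 : -((t - s) * H) ≤ reflDiff w l x := by
    have := mul_le_mul_of_nonneg_left hHl (by linarith : 0 ≤ t - s)
    linarith
  have hsp : 0 ≤ s ^ (p - 1) := Real.rpow_nonneg hs0.le _
  have h4 : γ * (-((t - s) * H)) * s ^ (p - 1) ≤ γ * reflDiff w l x * s ^ (p - 1) := by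
    gcongr
  have h5 : γ * ((t - s) * H) * s ^ (p - 1) ≤ γ * ((t - s) * H) * (a / (2 * γ * H)) :=
    mul_le_mul_of_nonneg_left h2 (mul_nonneg hγ.le (mul_nonneg (by linarith) hH0.le))
  have h6 : γ * ((t - s) * H) * (a / (2 * γ * H)) = a * (t - s) / 2 := by
    field_simp
  have h7 : 0 < a * (t - s) := mul_pos ha (by linarith)
  linarith

/-- The difference is at least `-u`, which tends to `0`, and it vanishes on the line, so a negative
infimum is attained in the open half plane. -/
theorem exists_isMin_of_neg (h : IsPositiveSolution γ p f u w) {l : ℝ} {x : ℂ} (hx : l < x.re)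
    (hneg : reflDiff u l x < 0) : ∃ y : ℂ, l < y.re ∧ reflDiff u l y < 0 ∧
      ∀ z : ℂ, l < z.re → reflDiff u l y ≤ reflDiff u l z := by
  obtain ⟨R, hR⟩ := h.exists_u_le (neg_pos.2 hneg)
  have hinf : ∀ᶠ z in cocompact ℂ ⊓ 𝓟 {z : ℂ | l ≤ z.re}, reflDiff u l x ≤ reflDiff u l z := by
    rw [eventually_inf_principal, eventually_cocompact_norm]
    refine ⟨R, fun z hz _ => ?_⟩
    have h1 := hR z hz
    have h2 := h.pos (reflectRe l z)
    have h3 : reflDiff u l z = u (reflectRe l z) - u z := rfl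
    linarith
  obtain ⟨y, hyl, hy⟩ := ContinuousOn.exists_isMinOn'
    (contDiff_reflDiff h.contDiff_u l).continuous.continuousOn (isClosed_le_re l) hx.le hinf
  have hyneg : reflDiff u l y < 0 := lt_of_le_of_lt (hy (show l ≤ x.re from hx.le)) hneg
  refine ⟨y, lt_of_le_of_ne hyl fun heq => ?_, hyneg, fun z hz => hy (show l ≤ z.re from hz.le)⟩
  exact hyneg.ne (reflDiff_of_re_eq u heq.symm)

/-- A negative minimum would lie in the ball of radius `R`, yet have real part greater than `l ≥ R`.
-/
theorem exists_good_of_ge (h : IsPositiveSolution γ p f u w) : ∃ l₁, ∀ l, l₁ ≤ l → Good u w l := by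
  obtain ⟨R, hR⟩ := h.exists_norm_lt_of_isMin 0
  refine ⟨max 0 R, fun l hl => h.good_of_reflDiff_u_nonneg fun x hx => ?_⟩
  by_contra! hneg
  obtain ⟨y, hyl, hyneg, hy⟩ := h.exists_isMin_of_neg hx hneg
  have h1 := hR l ((le_max_left _ _).trans hl) y hyl hyneg hy
  have h2 := Complex.re_le_norm y
  have h3 := (le_max_right 0 R).trans hl
  linarith

/-- For very negative `l` the mirror image of `0` is so far out that `w` is smaller there than at
`0`. -/
theorem exists_lt_of_good (h : IsPositiveSolution γ p f u w) : ∃ l₂, ∀ l, Good u w l → l₂ ≤ l := by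
  obtain ⟨R, hR⟩ := h.exists_w_le (w 0 - 1)
  refine ⟨-|R|, fun l hl => ?_⟩
  by_contra! hlt
  have hl0 : l < 0 := hlt.trans_le (neg_nonpos.2 (abs_nonneg R))
  have h1 := (hl 0 (by simpa using hl0)).2
  have h2 := hR (reflectRe l 0) (by
    have : ‖reflectRe l 0‖ = 2 * |l| := by simp [reflectRe]
    rw [this, abs_of_neg hl0]
    linarith [le_abs_self R])
  rw [reflDiff] at h1
  linarith

theorem good_of_forall_gt (h : IsPositiveSolution γ p f u w) {l : ℝ}
    (hl : ∀ m, l < m → Good u w m) : Good u w l := by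
  intro x hx
  have hcu : Continuous fun m => reflDiff u m x :=
    (continuous_reflDiff h.contDiff_u.continuous).comp (by fun_prop : Continuous fun m => (m, x))
  have hcw : Continuous fun m => reflDiff w m x :=
    (continuous_reflDiff h.contDiff_w.continuous).comp (by fun_prop : Continuous fun m => (m, x))
  have hev : ∀ᶠ m in 𝓝[>] l, 0 ≤ reflDiff u m x ∧ 0 ≤ reflDiff w m x := by
    filter_upwards [self_mem_nhdsWithin, nhdsWithin_le_nhds (eventually_lt_nhds hx)] with m h1 h2
    exact hl m h1 x h2
  exact ⟨ge_of_tendsto ((hcu.tendsto l).mono_left nhdsWithin_le_nhds) (hev.mono fun _ => And.left),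
    ge_of_tendsto ((hcw.tendsto l).mono_left nhdsWithin_le_nhds) (hev.mono fun _ => And.right)⟩

/-- When the reflected `u` dominates `u`, the difference of `w` is superharmonic, and the strong
maximum principle applies. -/
theorem reflDiff_w_eq_zero_or_pos (h : IsPositiveSolution γ p f u w) {l : ℝ} (hl : Good u w l) :
    (∀ x : ℂ, l < x.re → reflDiff w l x = 0) ∨ ∀ x : ℂ, l < x.re → 0 < reflDiff w l x := by
  by_cases hex : ∃ x : ℂ, l < x.re ∧ reflDiff w l x = 0
  · obtain ⟨x, hx, hx0⟩ := hex
    left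
    refine eqOn_zero_of_laplacian_nonpos (contDiff_reflDiff h.contDiff_w l) (isOpen_lt_re l)
      (convex_halfSpace_re_gt l).isPreconnected (fun y hy => ?_) (fun y hy => (hl y hy).2) hx hx0
    rw [h.laplacian_reflDiff_w, sub_nonpos]
    exact Real.rpow_le_rpow (h.pos y).le (sub_nonneg.1 (hl y hy).1) (by linarith [h.two_le])
  · push Not at hex
    exact Or.inr fun x hx => lt_of_le_of_ne (hl x hx).2 (hex x hx).symm

/-- At a zero of the difference of `u` the nonlinear bracket vanishes and the coupling alone makes
the Laplacian negative, which is impossible at a minimum. -/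
theorem reflDiff_u_pos (h : IsPositiveSolution γ p f u w) {l : ℝ} (hl : Good u w l)
    (hz : ∀ x : ℂ, l < x.re → 0 < reflDiff w l x) (x : ℂ) (hx : l < x.re) :
    0 < reflDiff u l x := by
  refine lt_of_le_of_ne (hl x hx).1 fun h0 => ?_
  have hmin : IsLocalMin (reflDiff u l) x :=
    isLocalMin_of_forall_lt_re hx fun y hy => by rw [← h0]; exact (hl y hy).1
  have hlap := hmin.laplacian_nonneg (contDiff_reflDiff h.contDiff_u l).contDiffAt
  have hs : u (reflectRe l x) = u x := sub_eq_zero.1 h0.symm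
  rw [h.laplacian_reflDiff_u, hs, sub_self, sub_self, mul_zero, add_zero, sub_zero] at hlap
  have h1 := hz x hx
  have h2 := h.gamma_pos
  have h3 := h.pos x
  have : 0 < γ * reflDiff w l x * u x ^ (p - 1) := by positivity
  linarith

/-- The Poisson equation recovers `u ^ p`, hence `u`, from `w`. -/
theorem reflDiff_u_eq_zero (h : IsPositiveSolution γ p f u w) {l : ℝ}
    (hz : ∀ x : ℂ, l < x.re → reflDiff w l x = 0) (x : ℂ) (hx : l < x.re) :
    reflDiff u l x = 0 := by
  have hev : reflDiff w l =ᶠ[𝓝 x] fun _ => 0 :=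
    Filter.mem_of_superset ((isOpen_lt_re l).mem_nhds hx) hz
  have hlap := (InnerProductSpace.laplacian_congr_nhds hev).self_of_nhds
  rw [h.laplacian_reflDiff_w, InnerProductSpace.laplacian_const] at hlap
  have h1 : u x ^ p = u (reflectRe l x) ^ p := sub_eq_zero.1 hlap
  have h2 := Real.rpow_left_injOn (x := p) (by linarith [h.two_le]) (h.pos x).le
    (h.pos (reflectRe l x)).le h1
  rw [reflDiff, h2, sub_self]

end IsPositiveSolution

/-! ### Hopf's lemma and pushing the plane further. -/

/-- Hopf's boundary lemma on a half plane, in the form of a linear lower bound. -/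
theorem exists_mul_le_of_laplacian_le {v : ℂ → ℝ} (hv : ContDiff ℝ 2 v) {l C : ℝ} (hC : 0 ≤ C)
    {x : ℂ} (hx : x.re = l) (h0 : ∀ y : ℂ, y.re = l → v y = 0) (hpos : ∀ y : ℂ, l < y.re → 0 < v y)
    (hlap : ∀ y : ℂ, l < y.re → y.re ≤ l + 1 → |y.im - x.im| ≤ Real.pi / 2 → Δ v y ≤ C * v y) :
    ∃ η > 0, ∀ t : ℝ, 0 < t → t < 1 → η * t ≤ v (x + t) := by
  have hpi := Real.pi_pos
  -- With this `k`, `(exp (k (re - l)) - 1) * cos (im - x.im)` is a strict subsolution of `Δ - C`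
  -- inside the rectangle. It vanishes on three sides, and `η` scales it below `v` on the fourth.
  set k := C + 1 with hk
  have hk0 : 0 < k := by linarith
  set Q : Set ℂ := Icc l (l + 1) ×ℂ Icc (x.im - Real.pi / 2) (x.im + Real.pi / 2) with hQ
  have hQc : IsCompact Q := isCompact_Icc.reProdIm isCompact_Icc
  have hSc : IsCompact ({l + 1} ×ℂ Icc (x.im - Real.pi / 2) (x.im + Real.pi / 2)) :=
    isCompact_singleton.reProdIm isCompact_Icc
  obtain ⟨a, ha, hamin⟩ := hSc.exists_isMinOn
    ⟨⟨l + 1, x.im⟩, by simp [Complex.mem_reProdIm]; positivity⟩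
    hv.continuous.continuousOn
  have ham : 0 < v a := hpos a (by
    have : a.re = l + 1 := ha.1
    linarith)
  set η := v a / Real.exp k with hη
  have hη0 : 0 < η := by positivity
  set φ : ℝ → ℝ := fun s => Real.exp (k * (s - l)) - 1 with hφ
  set ψ : ℝ → ℝ := fun s => Real.cos (s - x.im) with hψ
  have hφd : ∀ s, HasDerivAt φ (k * Real.exp (k * (s - l))) s := fun s => by
    have h1 : HasDerivAt (fun s => k * (s - l)) k s := by
      simpa using ((hasDerivAt_id s).sub_const l).const_mul k
    exact (h1.exp.sub_const 1).congr_deriv (mul_comm _ _)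
  have hφd2 : ∀ s, HasDerivAt (fun s => k * Real.exp (k * (s - l)))
      (k ^ 2 * Real.exp (k * (s - l))) s := fun s => by
    have h1 : HasDerivAt (fun s => k * (s - l)) k s := by
      simpa using ((hasDerivAt_id s).sub_const l).const_mul k
    refine (h1.exp.const_mul k).congr_deriv ?_
    ring
  have hψd : ∀ s, HasDerivAt ψ (-Real.sin (s - x.im)) s := fun s => by
    simpa using ((hasDerivAt_id s).sub_const x.im).cos
  have hψd2 : ∀ s,
      HasDerivAt (fun s => -Real.sin (s - x.im)) (-Real.cos (s - x.im)) s := fun s => by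
    have h1 : HasDerivAt (fun s => s - x.im) 1 s := (hasDerivAt_id s).sub_const x.im
    refine h1.sin.neg.congr_deriv ?_
    ring
  have hφc : ContDiff ℝ 2 φ := by fun_prop
  have hψc : ContDiff ℝ 2 ψ := by fun_prop
  have hbc := contDiff_mul_re_im hφc hψc
  set q : ℂ → ℝ := fun z => v z - η * (φ z.re * ψ z.im) with hq
  have hqc : ContDiff ℝ 2 q := hv.sub (contDiff_const.mul hbc)
  have hxQ : x ∈ Q := by
    rw [hQ, Complex.mem_reProdIm, hx]
    exact ⟨⟨le_rfl, by linarith⟩, ⟨by linarith, by linarith⟩⟩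
  obtain ⟨y, hyQ, hymin⟩ := hQc.exists_isMinOn ⟨x, hxQ⟩ hqc.continuous.continuousOn
  have hψnn : ∀ z ∈ Q, 0 ≤ ψ z.im := by
    intro z hz
    exact Real.cos_nonneg_of_neg_pi_div_two_le_of_le (by linarith [hz.2.1]) (by linarith [hz.2.2])
  have hφ1 : φ (l + 1) ≤ Real.exp k := by
    simp only [hφ, add_sub_cancel_left, mul_one]
    linarith
  have hqy : 0 ≤ q y := by
    by_contra! hneg
    have hy1 : l < y.re := by
      refine lt_of_le_of_ne hyQ.1.1 fun heq => ?_
      have h2 : φ y.re = 0 := by simp [hφ, ← heq]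
      simp only [hq, h2, h0 y heq.symm] at hneg
      linarith
    have hvy := hpos y hy1
    have hy2 : y.re < l + 1 := by
      refine lt_of_le_of_ne hyQ.1.2 fun heq => ?_
      have h1 : v a ≤ v y := hamin (show y ∈ _ from ⟨heq, hyQ.2⟩)
      have h2 : φ y.re * ψ y.im ≤ Real.exp k * 1 := by
        rw [heq]
        exact mul_le_mul hφ1 (Real.cos_le_one _) (hψnn y hyQ) (Real.exp_pos k).le
      have h3 : η * (φ y.re * ψ y.im) ≤ v a := by
        rw [hη, div_mul_eq_mul_div, div_le_iff₀ (Real.exp_pos k)]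
        exact mul_le_mul_of_nonneg_left (by linarith) ham.le
      simp only [hq] at hneg
      linarith
    have hψy : 0 < ψ y.im := by
      refine lt_of_le_of_ne (hψnn y hyQ) fun heq => ?_
      simp only [hq, ← heq] at hneg
      linarith
    have hy3 : x.im - Real.pi / 2 < y.im := by
      refine lt_of_le_of_ne hyQ.2.1 fun heq => ?_
      have : ψ y.im = 0 := by
        simp only [hψ, ← heq]
        rw [sub_right_comm, sub_self, zero_sub, Real.cos_neg, Real.cos_pi_div_two]
      linarith
    have hy4 : y.im < x.im + Real.pi / 2 := by
      refine lt_of_le_of_ne hyQ.2.2 fun heq => ?_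
      have : ψ y.im = 0 := by
        simp only [hψ, heq]
        rw [add_sub_cancel_left, Real.cos_pi_div_two]
      linarith
    have hmin : IsLocalMin q y := by
      refine hymin.isLocalMin (Filter.mem_of_superset
        ((isOpen_Ioo.reProdIm isOpen_Ioo).mem_nhds ⟨⟨hy1, hy2⟩, ⟨hy3, hy4⟩⟩) ?_)
      exact fun z hz => ⟨Ioo_subset_Icc_self hz.1, Ioo_subset_Icc_self hz.2⟩
    have hl := hmin.laplacian_nonneg hqc.contDiffAt
    rw [hq, laplacian_fun_sub hv.contDiffAt (contDiff_const.mul hbc).contDiffAt,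
      laplacian_const_mul _ hbc.contDiffAt, laplacian_mul_re_im hφc hψc hφd hφd2 hψd hψd2] at hl
    have h1 := hlap y hy1 hy2.le (abs_le.2 ⟨by linarith, by linarith⟩)
    have h2 : C * v y ≤ C * (η * (φ y.re * ψ y.im)) := by
      refine mul_le_mul_of_nonneg_left ?_ hC
      simp only [hq] at hneg
      linarith
    have h3 : C * (η * (φ y.re * ψ y.im)) - η * (k ^ 2 * Real.exp (k * (y.re - l)) * ψ y.im +
        φ y.re * -Real.cos (y.im - x.im)) = -(η * ψ y.im *
          (k + C * k * Real.exp (k * (y.re - l)))) := by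
      simp only [hφ, hψ, hk]
      ring
    have h4 : 0 < η * ψ y.im * (k + C * k * Real.exp (k * (y.re - l))) := by positivity
    linarith
  refine ⟨η * k, by positivity, fun t ht0 ht1 => ?_⟩
  have hre : (x + t).re = l + t := by simp [hx]
  have him : (x + t).im = x.im := by simp
  have h1 : q y ≤ q (x + t) := hymin (show x + (t : ℂ) ∈ Q by
    rw [hQ, Complex.mem_reProdIm, hre, him]
    exact ⟨⟨by linarith, by linarith⟩, ⟨by linarith, by linarith⟩⟩)
  simp only [hq, hre, him, hφ, hψ, add_sub_cancel_left, sub_self, Real.cos_zero, mul_one] at h1 hqy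
  have h2 := mul_le_mul_of_nonneg_left (Real.add_one_le_exp (k * t)) hη0.le
  linarith

namespace IsPositiveSolution

variable {γ p : ℝ} {f : ℝ → ℝ} {u w : ℂ → ℝ}

/-- By Hopf's lemma, the normal derivative of `u` does not vanish on the reflection line. -/
theorem fderiv_ne_zero_of_good (h : IsPositiveSolution γ p f u w) {l : ℝ} (hl : Good u w l)
    (hpos : ∀ x : ℂ, l < x.re → 0 < reflDiff u l x) {x : ℂ} (hx : x.re = l) :
    fderiv ℝ u x 1 ≠ 0 := by
  obtain ⟨M, hM⟩ := h.bdd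
  have hM0 : 0 < M := (h.pos 0).trans_le (hM 0)
  obtain ⟨L, hL0, hL⟩ := h.exists_lipschitz M
  have hp := h.two_le
  have hγ := h.gamma_pos
  obtain ⟨W, hW⟩ := ((isCompact_Icc (a := l) (b := l + 1)).reProdIm
    (isCompact_Icc (a := x.im - Real.pi / 2) (b := x.im + Real.pi / 2))).bddAbove_image
      h.contDiff_w.continuous.norm.continuousOn
  have hW0 : 0 ≤ W := (norm_nonneg _).trans (hW ⟨x, ⟨⟨hx.ge, by linarith⟩,
    ⟨by linarith [Real.pi_pos], by linarith [Real.pi_pos]⟩⟩, rfl⟩)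
  obtain ⟨η, hη, hlow⟩ := exists_mul_le_of_laplacian_le (contDiff_reflDiff h.contDiff_u l)
    -- `W` bounds `|w|` on the rectangle, `(p - 1) * M ^ (p - 2)` is the Lipschitz constant of the
    -- power on the range of `u`, and `L` is that of `f`. The coupling term has a favourable sign.
    (C := γ * W * ((p - 1) * M ^ (p - 2)) + L)
    (add_nonneg (mul_nonneg (by positivity) (mul_nonneg (by linarith) (by positivity))) hL0) hx
    (fun y hy => reflDiff_of_re_eq u hy) hpos (by
      intro y hy1 hy2 hy3
      rw [abs_le] at hy3
      have hwy : -W ≤ w y := (abs_le.1 (hW ⟨y, ⟨⟨hy1.le, hy2⟩,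
        ⟨by linarith [hy3.1], by linarith [hy3.2]⟩⟩, rfl⟩)).1
      have hz := (hl y hy1).2
      have hv := (hl y hy1).1
      rw [h.laplacian_reflDiff_u]
      have hvd : reflDiff u l y = u (reflectRe l y) - u y := rfl
      rw [hvd] at hv ⊢
      set s := u (reflectRe l y) with hs
      set t := u y with ht
      have hs0 : 0 < s := h.pos _
      have ht0 : 0 < t := h.pos _
      have h1 := mul_rpow_mul_sub_le_rpow_sub_rpow (q := p - 1) (by linarith) ht0.le hs0
      have h2 : s ^ (p - 1 - 1) ≤ M ^ (p - 2) := by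
        rw [show p - 1 - 1 = p - 2 by ring]
        exact Real.rpow_le_rpow hs0.le (hM _) (by linarith)
      have h3 : s ^ (p - 1) - t ^ (p - 1) ≤ (p - 1) * M ^ (p - 2) * (s - t) := by
        have : (p - 1) * s ^ (p - 1 - 1) * (s - t) ≤ (p - 1) * M ^ (p - 2) * (s - t) :=
          mul_le_mul_of_nonneg_right (mul_le_mul_of_nonneg_left h2 (by linarith)) hv
        linarith
      have h4 : 0 ≤ s ^ (p - 1) - t ^ (p - 1) :=
        sub_nonneg.2 (Real.rpow_le_rpow ht0.le (by linarith) (by linarith))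
      have h5 : -(γ * w y * (s ^ (p - 1) - t ^ (p - 1))) ≤
          γ * W * ((p - 1) * M ^ (p - 2) * (s - t)) := by
        have h6 : -(γ * w y) * (s ^ (p - 1) - t ^ (p - 1)) ≤
            γ * W * (s ^ (p - 1) - t ^ (p - 1)) :=
          mul_le_mul_of_nonneg_right (by nlinarith) h4
        have h7 : γ * W * (s ^ (p - 1) - t ^ (p - 1)) ≤
            γ * W * ((p - 1) * M ^ (p - 2) * (s - t)) :=
          mul_le_mul_of_nonneg_left h3 (by positivity)
        linarith
      have h8 := hL s t hs0.le (hM _) ht0.le (hM _)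
      rw [abs_of_nonneg hv] at h8
      have h9 : 0 ≤ γ * reflDiff w l y * s ^ (p - 1) := by positivity
      linarith [neg_abs_le (f s - f t)])
  intro hd
  have hder := hasDerivAt_reflDiff (h.contDiff_u.differentiable (by norm_num)) l x
  rw [reflectRe_of_re_eq hx, hd] at hder
  have hlim := hder.tendsto_slope_zero_right
  have : η ≤ -0 - 0 := by
    refine ge_of_tendsto hlim ?_
    filter_upwards [self_mem_nhdsWithin, nhdsWithin_le_nhds (eventually_lt_nhds one_pos)]
      with t ht0 ht1
    have h1 := hlow t ht0 ht1
    have ht0' : (0 : ℝ) < t := ht0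
    simp only [zero_add, Complex.ofReal_zero, add_zero, reflDiff_of_re_eq u hx, sub_zero,
      smul_eq_mul]
    rw [inv_mul_eq_div, le_div_iff₀ ht0']
    exact h1
  linarith

/-- The moving plane can be pushed further unless it is a plane of symmetry. -/
theorem exists_good_of_lt (h : IsPositiveSolution γ p f u w) {l : ℝ} (hl : Good u w l)
    (hpos : ∀ x : ℂ, l < x.re → 0 < reflDiff u l x) :
    ∃ ε > 0, ∀ m, l - ε < m → m ≤ l → Good u w m := by
  by_contra! hcon
  obtain ⟨R, hR⟩ := h.exists_norm_lt_of_isMin (l - 1)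
  have hud : Differentiable ℝ u := h.contDiff_u.differentiable (by norm_num)
  -- Failure for lines tending to `l` yields negative minima in a fixed ball. A limit point must lie
  -- on `re = l`, and the vanishing horizontal derivatives become `-2 * ∂₁u = 0` there, against
  -- Hopf's lemma.
  have hseq : ∀ n : ℕ, ∃ m : ℝ, ∃ x : ℂ, l - 1 / (n + 1 : ℝ) < m ∧ m ≤ l ∧ m < x.re ∧
      reflDiff u m x < 0 ∧ x ∈ Metric.closedBall (0 : ℂ) R ∧
      -fderiv ℝ u (reflectRe m x) 1 - fderiv ℝ u x 1 = 0 := by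
    intro n
    obtain ⟨m, hm1, hm2, hm3⟩ := hcon (1 / (n + 1 : ℝ)) (by positivity)
    have hnot : ∃ x : ℂ, m < x.re ∧ reflDiff u m x < 0 := by
      by_contra! hall
      exact hm3 (h.good_of_reflDiff_u_nonneg hall)
    obtain ⟨x, hx, hneg⟩ := hnot
    obtain ⟨y, hy1, hy2, hy3⟩ := h.exists_isMin_of_neg hx hneg
    refine ⟨m, y, hm1, hm2, hy1, hy2, ?_, ?_⟩
    · have hn : (1 : ℝ) / (n + 1) ≤ 1 := by
        rw [div_le_one (by positivity)]
        linarith [Nat.cast_nonneg (α := ℝ) n]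
      rw [mem_closedBall_zero_iff]
      exact (hR m (by linarith) y hy1 hy2 hy3).le
    · have hder := hasDerivAt_reflDiff hud m y
      refine IsLocalMin.hasDerivAt_eq_zero (f := fun t : ℝ => reflDiff u m (y + t)) (a := 0) ?_ hder
      have hmin := isLocalMin_of_forall_lt_re hy1 hy3
      have ht : Tendsto (fun t : ℝ => y + (t : ℂ)) (𝓝 0) (𝓝 y) := by
        have : Continuous fun t : ℝ => y + (t : ℂ) := by fun_prop
        simpa using this.tendsto 0
      have := ht.eventually hmin
      simpa [IsLocalMin, IsMinFilter] using this
  choose m x hm1 hm2 hx1 hx2 hx3 hx4 using hseq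
  obtain ⟨a, -, σ, hσ, ha⟩ := (isCompact_closedBall (0 : ℂ) R).tendsto_subseq hx3
  have hm : Tendsto m atTop (𝓝 l) := by
    refine tendsto_of_tendsto_of_tendsto_of_le_of_le (g := fun n : ℕ => l - 1 / (n + 1 : ℝ)) ?_
      tendsto_const_nhds (fun n => (hm1 n).le) hm2
    simpa using tendsto_one_div_add_atTop_nhds_zero_nat.const_sub l
  have hpair : Tendsto (fun n => (m (σ n), x (σ n))) atTop (𝓝 (l, a)) :=
    (hm.comp hσ.tendsto_atTop).prodMk_nhds ha
  have hre : l ≤ a.re := le_of_tendsto_of_tendsto (hm.comp hσ.tendsto_atTop)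
    ((Complex.continuous_re.tendsto a).comp ha) (Eventually.of_forall fun n => (hx1 (σ n)).le)
  have hle : reflDiff u l a ≤ 0 := le_of_tendsto
    (((continuous_reflDiff h.contDiff_u.continuous).tendsto (l, a)).comp hpair)
    (Eventually.of_forall fun n => (hx2 (σ n)).le)
  have hal : a.re = l := by
    refine le_antisymm ?_ hre
    by_contra! hlt
    exact absurd (hpos a hlt) (not_lt.2 hle)
  have hfc : Continuous fun z => fderiv ℝ u z 1 :=
    (h.contDiff_u.continuous_fderiv (by norm_num)).clm_apply continuous_const
  have hdc : Continuous fun q : ℝ × ℂ => -fderiv ℝ u (reflectRe q.1 q.2) 1 - fderiv ℝ u q.2 1 :=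
    ((hfc.comp continuous_reflectRe).neg).sub (hfc.comp continuous_snd)
  have hlim := (hdc.tendsto (l, a)).comp hpair
  have hzero := tendsto_nhds_unique hlim
    (tendsto_const_nhds.congr fun n => (hx4 (σ n)).symm)
  simp only [reflectRe_of_re_eq hal] at hzero
  exact h.fderiv_ne_zero_of_good hl hpos hal (by linarith)

/-! ### The limiting symmetry line and radial symmetry. -/

/-- Symmetry of `w` about two different parallel lines is impossible. -/
theorem not_forall_reflDiff_w_eq_zero (h : IsPositiveSolution γ p f u w) {l m : ℝ} (hlm : l < m)
    (hl : ∀ x, w (reflectRe l x) = w x) (hm : ∀ x, w (reflectRe m x) = w x) : False := by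
  -- Two parallel reflections compose to a translation, and a periodic `w` cannot tend to `-∞`.
  have hper : ∀ x : ℂ, w (x + 2 * (m - l)) = w x := by
    intro x
    rw [← hl x, ← hm (reflectRe l x)]
    congr 1
    apply Complex.ext <;> simp
    ring
  have hiter : ∀ n : ℕ, w (n * (2 * (m - l))) = w 0 := by
    intro n
    induction n with
    | zero => simp
    | succ n ih =>
      rw [← ih, ← hper (n * (2 * (m - l)))]
      congr 1
      push_cast; ring
  obtain ⟨R, hR⟩ := h.exists_w_le (w 0 - 1)
  obtain ⟨n, hn⟩ := exists_nat_ge (R / (2 * (m - l)))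
  have hpos : 0 < 2 * (m - l) := by linarith
  rw [div_le_iff₀ hpos] at hn
  have h1 := hR (n * (2 * (m - l))) (by
    have : ((n : ℂ) * (2 * (m - l))) = ((n * (2 * (m - l)) : ℝ) : ℂ) := by push_cast; rfl
    rw [this, Complex.norm_real, Real.norm_of_nonneg (by positivity)]
    exact hn)
  rw [hiter] at h1
  linarith

theorem reflect_eq_of_forall_lt {g : ℂ → ℝ} {l : ℝ}
    (h : ∀ x : ℂ, l < x.re → reflDiff g l x = 0) (x : ℂ) : g (reflectRe l x) = g x := by
  rcases lt_trichotomy l x.re with hx | hx | hx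
  · exact sub_eq_zero.1 (h x hx)
  · rw [reflectRe_of_re_eq hx.symm]
  · have := h (reflectRe l x) (by rw [reflectRe_re]; linarith)
    rw [reflDiff, reflectRe_reflectRe, sub_eq_zero] at this
    exact this.symm

/-- The moving plane method in the direction of the real axis. -/
theorem exists_symmetry_line (h : IsPositiveSolution γ p f u w) :
    ∃ l, (∀ x, u (reflectRe l x) = u x) ∧ (∀ x, w (reflectRe l x) = w x) ∧
      ∀ m, l < m → ∀ x : ℂ, m < x.re → u x < u (reflectRe m x) ∧ w x < w (reflectRe m x) := by
  -- Asking for all `m ≥ l` makes `T` upward closed, so every position above its infimum is good.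
  set T : Set ℝ := {l | ∀ m, l ≤ m → Good u w m} with hT
  have hne : T.Nonempty := h.exists_good_of_ge
  have hbdd : BddBelow T := by
    obtain ⟨l₂, hl₂⟩ := h.exists_lt_of_good
    exact ⟨l₂, fun l hl => hl₂ l (hl l le_rfl)⟩
  set l := sInf T with hl
  have hgt : ∀ m, l < m → Good u w m := by
    intro m hm
    obtain ⟨t, ht, htm⟩ := exists_lt_of_csInf_lt hne hm
    exact ht m htm.le
  have hgood : Good u w l := h.good_of_forall_gt hgt
  have hz : ∀ x : ℂ, l < x.re → reflDiff w l x = 0 := by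
    refine (h.reflDiff_w_eq_zero_or_pos hgood).resolve_right fun hpos => ?_
    obtain ⟨ε, hε, hext⟩ := h.exists_good_of_lt hgood (h.reflDiff_u_pos hgood hpos)
    have hmem : l - ε / 2 ∈ T := by
      intro m hm
      rcases le_or_gt m l with h1 | h1
      · exact hext m (by linarith) h1
      · exact hgt m h1
    have := csInf_le hbdd hmem
    linarith
  have hws := reflect_eq_of_forall_lt hz
  refine ⟨l, reflect_eq_of_forall_lt (h.reflDiff_u_eq_zero hz), hws, fun m hm x hx => ?_⟩
  have hzm : ∀ x : ℂ, m < x.re → 0 < reflDiff w m x := by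
    refine (h.reflDiff_w_eq_zero_or_pos (hgt m hm)).resolve_left fun h0 => ?_
    exact h.not_forall_reflDiff_w_eq_zero hm hws (reflect_eq_of_forall_lt h0)
  exact ⟨sub_pos.1 (h.reflDiff_u_pos (hgt m hm) hzm x hx), sub_pos.1 (hzm x hx)⟩

/-- The symmetry line passes through every maximum point of `w`. -/
theorem symmetry_of_isMax (h : IsPositiveSolution γ p f u w) {x₀ : ℂ} (hx₀ : ∀ x, w x ≤ w x₀) :
    (∀ x, u (reflectRe x₀.re x) = u x) ∧ (∀ x, w (reflectRe x₀.re x) = w x) ∧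
      ∀ m, x₀.re < m → ∀ x : ℂ, m < x.re → u x < u (reflectRe m x) ∧ w x < w (reflectRe m x) := by
  obtain ⟨l, hu, hw, hmono⟩ := h.exists_symmetry_line
  -- Reflecting a maximum lying to the right of the axis would strictly increase `w`. Applied to
  -- `x₀` and to its mirror image, this places `x₀` on the axis.
  have hnot : ∀ y : ℂ, (∀ x, w x ≤ w y) → y.re ≤ l := by
    intro y hy
    by_contra! hlt
    have := (hmono ((l + y.re) / 2) (by linarith) y (by linarith)).2
    exact absurd (hy _) (not_le.2 this)
  have h1 := hnot x₀ hx₀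
  have h2 := hnot (reflectRe l x₀) (by rwa [hw])
  rw [reflectRe_re] at h2
  obtain rfl : x₀.re = l := by linarith
  exact ⟨hu, hw, hmono⟩

/-- A fixed maximum point of `w` lies on the symmetry axis for every direction, so all the axes are
concurrent. -/
theorem exists_radial (h : IsPositiveSolution γ p f u w) :
    ∃ x₀ : ℂ, ∃ φ ψ : ℝ → ℝ, StrictAntiOn φ (Ici 0) ∧ StrictAntiOn ψ (Ici 0) ∧
      (∀ x, u x = φ ‖x - x₀‖) ∧ ∀ x, w x = ψ ‖x - x₀‖ := by
  obtain ⟨x₀, hx₀⟩ := h.exists_max_w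
  have hdec : ∀ r s : ℝ, 0 ≤ r → r < s → u (x₀ + s) < u (x₀ + r) ∧ w (x₀ + s) < w (x₀ + r) := by
    intro r s hr hrs
    have := (h.symmetry_of_isMax hx₀).2.2 (x₀.re + (r + s) / 2) (by linarith) (x₀ + s)
      (by simp; linarith)
    have e : reflectRe (x₀.re + (r + s) / 2) (x₀ + s) = x₀ + r := by
      apply Complex.ext <;> simp
      ring
    rwa [e] at this
  have hsymm : ∀ θ r : ℝ, u (x₀ + r * Complex.exp (θ * Complex.I)) = u (x₀ + r) ∧
      w (x₀ + r * Complex.exp (θ * Complex.I)) = w (x₀ + r) := by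
    intro θ r
    -- The reflection through `x₀` with normal direction `a` sends `x₀ + r` to `x₀ - a² r`, so the
    -- requirement is `-a² = exp (θ I)`.
    set a : Circle := Circle.exp ((θ + Real.pi) / 2) with ha
    have hLa : ∀ y, rotation a y = a * y := fun y => rotation_apply a y
    have haa : (a : ℂ) * a = -Complex.exp (θ * Complex.I) := by
      rw [ha, Circle.coe_exp, ← Complex.exp_add]
      have : (((θ + Real.pi) / 2 : ℝ) : ℂ) * Complex.I + (((θ + Real.pi) / 2 : ℝ) : ℂ) * Complex.I =
          θ * Complex.I + Real.pi * Complex.I := by push_cast; ring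
      rw [this, Complex.exp_add, Complex.exp_pi_mul_I]; ring
    have hconj : (a : ℂ) * (starRingEnd ℂ) (a : ℂ) = 1 := by
      rw [Complex.mul_conj, Circle.normSq_coe]; simp
    set c : ℂ := (starRingEnd ℂ) (a : ℂ) with hc
    have hcx : ∀ y : ℂ, rotation a (c * y) = y := fun y => by
      rw [hLa, ← mul_assoc, hconj, one_mul]
    have hsol := (h.comp_isometry (rotation a)).symmetry_of_isMax (x₀ := c * x₀)
      (fun x => by simp only [hcx]; exact hx₀ _)
    have e : rotation a (reflectRe (c * x₀).re (c * (x₀ + r))) =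
        x₀ + r * Complex.exp (θ * Complex.I) := by
      have h1 : (2 : ℂ) * ((c * x₀).re : ℝ) = c * x₀ + (starRingEnd ℂ) (c * x₀) := by
        rw [Complex.add_conj]; push_cast; ring
      have h2 : (starRingEnd ℂ) c = a := Complex.conj_conj _
      rw [hLa, reflectRe, h1]
      simp only [map_mul, map_add, h2, Complex.conj_ofReal]
      linear_combination x₀ * hconj - r * haa
    have h1 := hsol.1 (c * (x₀ + r))
    have h2 := hsol.2.1 (c * (x₀ + r))
    simp only [e, hcx] at h1 h2
    exact ⟨h1, h2⟩
  have hpolar : ∀ x : ℂ, x = x₀ + (‖x - x₀‖ : ℝ) * Complex.exp ((x - x₀).arg * Complex.I) := by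
    intro x
    rw [Complex.norm_mul_exp_arg_mul_I, add_sub_cancel]
  refine ⟨x₀, fun r => u (x₀ + r), fun r => w (x₀ + r), fun r hr s _ hrs => (hdec r s hr hrs).1,
    fun r hr s _ hrs => (hdec r s hr hrs).2, fun x => ?_, fun x => ?_⟩
  · conv_lhs => rw [hpolar x]
    exact (hsymm _ _).1
  · conv_lhs => rw [hpolar x]
    exact (hsymm _ _).2

end IsPositiveSolution

/-! ### Transfer to the Euclidean plane. -/

/-- By continuity a violation would hold on a nonempty open set, which has positive measure. -/
theorem exists_forall_le_of_memLp_top {u : EuclideanSpace ℝ (Fin 2) → ℝ} (hc : Continuous u)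
    (hu : MemLp u ⊤ volume) : ∃ M, ∀ x, u x ≤ M := by
  set M := (eLpNorm u ⊤ volume).toReal with hM
  refine ⟨M, fun x => ?_⟩
  by_contra! hx
  have hopen : IsOpen {y | M < u y} := isOpen_lt continuous_const hc
  have hpos := hopen.measure_pos volume ⟨x, hx⟩
  have hae : ∀ᵐ y ∂(volume : Measure (EuclideanSpace ℝ (Fin 2))), u y ≤ M := by
    have h1 := enorm_ae_le_eLpNormEssSup u volume
    filter_upwards [h1] with y hy
    rw [← eLpNorm_exponent_top] at hy
    have := ENNReal.toReal_mono hu.2.ne hy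
    rw [toReal_enorm] at this
    exact (Real.le_norm_self _).trans this
  refine hpos.ne' (measure_mono_null (fun y hy => ?_) (ae_iff.1 hae))
  exact not_le.2 hy

theorem theorem1p4 (γ : ℝ) (hγ : 0 < γ) (p : ℝ) (hp : 2 ≤ p)
    (f : ℝ → ℝ) (hf : LocallyLipschitz f) (hf0 : f 0 = 0)
    (hmono : 2 < p → ∃ ε₀ > 0, ∃ a₀ > 0, ∀ s t : ℝ, 0 < s → s < ε₀ → 0 < t → t < ε₀ → s ≠ t →
      (f s - f t) / (s - t) ≤ -a₀)
    (u w : EuclideanSpace ℝ (Fin 2) → ℝ) (hsol : IsClassicalSolution γ p f u w)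
    (hu_pos : ∀ x, 0 < u x) (hu_bdd : MemLp u ⊤ volume)
    (hw : Tendsto w (cocompact (EuclideanSpace ℝ (Fin 2))) atBot) :
    ∃ x₀ : EuclideanSpace ℝ (Fin 2),
      IsRadiallyStrictlyDecreasing u x₀ ∧ IsRadiallyStrictlyDecreasing w x₀ := by
  set e := Complex.orthonormalBasisOneI.repr with he
  obtain ⟨M, hM⟩ := exists_forall_le_of_memLp_top hsol.contDiff_u.continuous hu_bdd
  have h : IsPositiveSolution γ p f (fun z => u (e z)) (fun z => w (e z)) :=
    { gamma_pos := hγ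
      two_le := hp
      lip := hf
      map_zero := hf0
      mono := hmono
      contDiff_u := hsol.contDiff_u.comp e.contDiff
      contDiff_w := hsol.contDiff_w.comp e.contDiff
      lap_u := fun z => by
        have h1 := laplacian_comp_isometry u e 0 z
        simp only [add_zero] at h1
        have h2 := hsol.eq_u (e z)
        have h3 := hu_pos (e z)
        -- Positivity of `u` merges `|u| ^ (p - 2) * u` into `u ^ (p - 1)`.
        rw [abs_of_pos h3, mul_assoc, ← Real.rpow_add_one h3.ne',
          show p - 2 + 1 = p - 1 by ring] at h2
        rw [h1]
        linarith
      lap_w := fun z => by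
        have h1 := laplacian_comp_isometry w e 0 z
        simp only [add_zero] at h1
        have h2 := hsol.eq_w (e z)
        rw [abs_of_pos (hu_pos (e z))] at h2
        rw [h1]
        linarith
      pos := fun z => hu_pos _
      bdd := ⟨M, fun z => hM _⟩
      tendsto_w := hw.comp e.toHomeomorph.isClosedEmbedding.tendsto_cocompact }
  obtain ⟨x₀, φ, ψ, hφ, hψ, hu, hw'⟩ := h.exists_radial
  have hnorm : ∀ x, ‖e.symm x - x₀‖ = ‖x - e x₀‖ := fun x => by
    rw [← e.norm_map, map_sub, e.apply_symm_apply]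
  refine ⟨e x₀, ⟨φ, hφ, fun x => ?_⟩, ⟨ψ, hψ, fun x => ?_⟩⟩
  · have := hu (e.symm x)
    rwa [hnorm, e.apply_symm_apply] at this
  · have := hw' (e.symm x)
    rwa [hnorm, e.apply_symm_apply] at this
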